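/- Let $L$ be a nonempty finite set of labels and, for every $a\in L$, let $\mathcal H_a$ be a complex Hilbert space with $1<\dim\mathcal H_a<\infty$; put $\mathcal H_K=\bigotimes_{a\in K}\mathcal H_a$ for $K\subseteq L$ and $\mathcal H=\mathcal H_L$. Let $\mathcal P_K$ be the set of pure states (self-adjoint projectors of trace one) on $\mathcal H_K$, $\mathcal P=\mathcal P_L$, and let $\mathcal D=\operatorname{Conv}\mathcal P$ be the set of mixed states on $\mathcal H$. Partitions of $L$ are ordered by refinement ($\beta\preceq\alpha$ iff every part of $\beta$ is contained in a part of $\alpha$), and nonempty down-sets $\vec\alpha$ of partitions are ordered by inclusion: $\vec\beta\preceq\vec\alpha$ iff $\vec\beta\subseteq\vec\alpha$. For a partition $\alpha$ let $\mathcal P_\alpha$ be the set of the states $\bigotimes_{K\in\alpha}\pi_K$ with $\pi_K\in\mathcal P_K$; for a nonempty down-set $\vec\alpha$ let $\mathcal P_{\vec\alpha}=\bigcup_{\alpha\in\vec\alpha}\mathcal P_\alpha$ and $\mathcal D_{\vec\alpha}=\operatorname{Conv}\mathcal P_{\vec\alpha}$. With the von Neumann entropy $S(\varrho)=-\operatorname{tr}(\varrho\ln\varrho)$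 and the reduced states $\pi_K=\operatorname{tr}_{L\setminus K}\pi$, put for $\pi\in\mathcal P$ $$E_\alpha(\pi)=\tfrac12\sum_{K\in\alpha}S(\pi_K),\qquad E_{\vec\alpha}(\pi)=\min_{\alpha\in\vec\alpha}E_\alpha(\pi),$$ and define the $\vec\alpha$-entanglement of formation of $\varrho\in\mathcal D$ as the convex roof extension $$E^{\mathrm{oF}}_{\vec\alpha}(\varrho)=\min\Bigl\{\sum_i p_iE_{\vec\alpha}(\pi_i)\;:\;\varrho=\sum_i p_i\pi_i\Bigr\},$$ over all finite decompositions of $\varrho$ with $p_i\ge0$, $\sum_ip_i=1$, $\pi_i\in\mathcal P$. An LOCC transformation with suboperations $\Lambda_1,\dots,\Lambda_m$ is a finite-round protocol, in which in each round one party $a\in L$, which may depend on the earlier results, measures $\mathcal H_a$ with finitely many Kraus operators $M_j$ on $\mathcal H_a$, $\sum_jM_j^\dagger M_j=\mathrm I$, and announces the result, each run of the protocol being finally assigned one of $m$ outcomes and $\Lambda_i$ being the sum over the runs with outcome $i$; or it is a pointwise limit of such $m$-outcome protocols. Then for every nonempty down-set $\vec\alpha$ of partitions the following hold. 1. The minimum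 defining $E^{\mathrm{oF}}_{\vec\alpha}(\varrho)$ is attained for every $\varrho\in\mathcal D$. 2. $E^{\mathrm{oF}}_{\vec\alpha}$ is an entanglement monotone: it is convex on $\mathcal D$, and it is nonincreasing on average under LOCC, that is, $\sum_i p_iE^{\mathrm{oF}}_{\vec\alpha}(\tfrac1{p_i}\Lambda_i(\varrho))\le E^{\mathrm{oF}}_{\vec\alpha}(\varrho)$ for every $\varrho\in\mathcal D$ and every LOCC transformation with suboperations $\Lambda_i$, where $p_i=\operatorname{tr}\Lambda_i(\varrho)$ and the sum runs over the $i$ with $p_i>0$. 3. For $\varrho\in\mathcal D$: $\varrho\in\mathcal D_{\vec\alpha}$ if and only if $E^{\mathrm{oF}}_{\vec\alpha}(\varrho)=0$. 4. For $\varrho\in\mathcal D$: $0\le E^{\mathrm{oF}}_{\vec\alpha}(\varrho)\le\frac12\ln\dim\mathcal H=\frac12\sum_{a\in L}\ln\dim\mathcal H_a$. Moreover the family is multipartite monotonic: for all nonempty down-sets $\vec\alpha,\vec\beta$ of partitions, $\vec\beta\preceq\vec\alpha$ if and only if $E^{\mathrm{oF}}_{\vec\beta}(\varrho)\ge E^{\mathrm{oF}}_{\vec\alpha}(\varrho)$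 for all $\varrho\in\mathcal D$. -/

import Mathlib

open Filter Topology

noncomputable section

namespace PartialEnt

/-! ### Pure and mixed states of a Hilbert space with a fixed finite orthonormal basis

Operators on `ℂ^ι` are written as their matrices in the standard basis. -/

section States

variable (ι : Type*) [Fintype ι]

/-- Pure states: the self-adjoint projectors of unit trace. -/
def pureStates : Set (Matrix ι ι ℂ) :=
  {π | π.IsHermitian ∧ π * π = π ∧ π.trace = 1}

/-- Mixed states: the convex combinations of pure states. -/
def mixedStates : Set (Matrix ι ι ℂ) :=
  convexHull ℝ (pureStates ι)

end States

/-- The von Neumann entropy `S(ρ) = - tr (ρ ln ρ)`, with `0 ln 0 = 0`; the logarithm of the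
self-adjoint matrix `ρ` is taken by the functional calculus. -/
def entropy {ι : Type*} [Fintype ι] [DecidableEq ι] (ρ : Matrix ι ι ℂ) : ℝ :=
  -(ρ * cfc Real.log ρ).trace.re

/-- The values `∑ i, p i * f (π i)` over all finite pure state decompositions
`ρ = ∑ i, p i • π i` of `ρ`. -/
def roofValues {ι : Type*} [Fintype ι] (f : Matrix ι ι ℂ → ℝ) (ρ : Matrix ι ι ℂ) : Set ℝ :=
  {t | ∃ (m : ℕ) (p : Fin m → ℝ) (π : Fin m → Matrix ι ι ℂ),
    (∀ i, 0 ≤ p i) ∧ ∑ i, p i = 1 ∧ (∀ i, π i ∈ pureStates ι) ∧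
    ∑ i, p i • π i = ρ ∧ t = ∑ i, p i * f (π i)}

/-- The convex roof extension of a function of pure states. -/
def convexRoof {ι : Type*} [Fintype ι] (f : Matrix ι ι ℂ → ℝ) (ρ : Matrix ι ι ℂ) : ℝ :=
  sInf (roofValues f ρ)

/-! ### Multipartite systems

`L` is the set of labels of the elementary subsystems and `d a` is the dimension of the Hilbert
space of the elementary subsystem `a`. -/

section Systems

variable {L : Type*} [Fintype L] [DecidableEq L] (d : L → ℕ)

/-- The product basis of the Hilbert space of the whole system. -/
abbrev Config : Type _ := (a : L) → Fin (d a)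

/-- The product basis of the Hilbert space of the subsystem `K`. -/
abbrev SubConfig (K : Finset L) : Type _ := (a : K) → Fin (d a)

/-- The Hilbert space of the whole system: the tensor product of the spaces `ℂ^(d a)`. -/
abbrev HilbertSpace : Type _ := EuclideanSpace ℂ (Config d)

/-- The operators on the Hilbert space of the whole system. -/
abbrev Op : Type _ := Matrix (Config d) (Config d) ℂ

variable {d}

/-- The basis label `(x, z)` of the whole system that is assembled from a basis label of the
subsystem `K` and one of its complement. -/
def glue {K : Finset L} (x : SubConfig d K) (z : (a : {a : L // a ∉ K}) → Fin (d a)) :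
    Config d :=
  (Equiv.piEquivPiSubtypeProd (fun a => a ∈ K) (fun a => Fin (d a))).symm (x, z)

/-- The reduced operator on the subsystem `K`: the partial trace over the complement of `K`. -/
def reduced (K : Finset L) (X : Op d) : Matrix (SubConfig d K) (SubConfig d K) ℂ :=
  Matrix.of fun x y => ∑ z : (a : {a : L // a ∉ K}) → Fin (d a), X (glue x z) (glue y z)

variable (L) in
/-- The partitions of the set of labels; `β ≤ α` means that `β` is finer than `α`. -/
abbrev PI : Type _ := Finpartition (Finset.univ : Finset L)

variable (L) in
/-- The nonempty down-sets of partitions, ordered by inclusion. -/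
abbrev PII : Type _ := {s : LowerSet (PI L) // (s : Set (PI L)).Nonempty}

/-- The tensor product of operators `φ K` on the parts `K` of the partition `α`. -/
def tensorParts (α : PI L) (φ : (K : Finset L) → Matrix (SubConfig d K) (SubConfig d K) ℂ) :
    Op d :=
  Matrix.of fun x y => ∏ K ∈ α.parts, φ K (fun a => x a) (fun a => y a)

variable (d)

/-- The `α`-separable pure states, for a partition `α`. -/
def sepPure (α : PI L) : Set (Op d) :=
  {π | ∃ φ : (K : Finset L) → Matrix (SubConfig d K) (SubConfig d K) ℂ,
    (∀ K ∈ α.parts, φ K ∈ pureStates (SubConfig d K)) ∧ π = tensorParts α φ}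

/-- The `A`-separable pure states, for a nonempty down-set `A` of partitions. -/
def sepPureII (A : PII L) : Set (Op d) :=
  ⋃ α ∈ A.1, sepPure d α

/-- The `A`-separable mixed states, for a nonempty down-set `A` of partitions. -/
def sepMixedII (A : PII L) : Set (Op d) :=
  convexHull ℝ (sepPureII d A)

variable {d}

/-- The `α`-entanglement entropy of a pure state, for a partition `α`. -/
def entI (α : PI L) (π : Op d) : ℝ :=
  (1 / 2) * ∑ K ∈ α.parts, entropy (reduced K π)

/-- The `A`-entanglement entropy of a pure state, for a nonempty down-set `A` of partitions: the
minimum of the `α`-entanglement entropies over the finitely many `α` in `A`. -/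
def entII (A : PII L) (π : Op d) : ℝ :=
  sInf ((fun α => entI α π) '' (A.1 : Set (PI L)))

/-- The `A`-entanglement of formation. -/
def entOF (A : PII L) (ρ : Op d) : ℝ :=
  convexRoof (entII A) ρ

/-! ### Local operations and classical communication -/

/-- The operator acting as `M` on the elementary subsystem `a` and as the identity on all the
others. -/
def localOp (a : L) (M : Matrix (Fin (d a)) (Fin (d a)) ℂ) : Op d :=
  Matrix.of fun x y => if ∀ b, b ≠ a → x b = y b then M (x a) (y a) else 0

/-- `FiniteLOCC Λ`: the suboperations `Λ i` (one for every final outcome `i`) are realized by an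
LOCC protocol with finitely many rounds. Either the protocol ends, recording an outcome `i₀`; or
some party `a` performs a measurement with Kraus operators `M j` on its elementary subsystem and
announces the result `j`, and the parties go on with a protocol that may depend on `j`.
Different runs may record the same final outcome, whose suboperation is then the sum over these
runs: the parties may forget information, and local operations with more than one Kraus operator
are covered. -/
inductive FiniteLOCC {m : ℕ} : (Fin m → Op d → Op d) → Prop
  | halt (i₀ : Fin m) : FiniteLOCC (fun i X => if i = i₀ then X else 0)
  | measure (a : L) (k : ℕ) (M : Fin k → Matrix (Fin (d a)) (Fin (d a)) ℂ)
      (hM : ∑ j, (M j).conjTranspose * M j = 1)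
      (Λ : Fin k → Fin m → Op d → Op d) (hΛ : ∀ j, FiniteLOCC (Λ j)) :
      FiniteLOCC
        (fun i X => ∑ j, Λ j i (localOp a (M j) * X * (localOp a (M j)).conjTranspose))

/-- An LOCC transformation `∑ i, Λ i` with suboperations `Λ i`: a finite-round protocol, or a limit
of such protocols (which includes the protocols with unboundedly many rounds). -/
def IsLOCC {m : ℕ} (Λ : Fin m → Op d → Op d) : Prop :=
  ∃ Λs : ℕ → Fin m → Op d → Op d, (∀ N, FiniteLOCC (Λs N)) ∧
    ∀ i X, Tendsto (fun N => Λs N i X) atTop (𝓝 (Λ i X))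

/-- Entanglement monotones: functions on mixed states that are convex and nonincreasing on average
under LOCC. An outcome `i` of probability `p i = tr (Λ i ρ) = 0` contributes the summand `0`. -/
def IsEntanglementMonotone (f : Op d → ℝ) : Prop :=
  ConvexOn ℝ (mixedStates (Config d)) f ∧
  ∀ (m : ℕ) (Λ : Fin m → Op d → Op d), IsLOCC Λ → ∀ ρ ∈ mixedStates (Config d),
    ∑ i, (Λ i ρ).trace.re * f ((Λ i ρ).trace.re⁻¹ • Λ i ρ) ≤ f ρ

end Systems

end PartialEnt

end

/-!
Throughout, `entOF A` is the convex roof of `entII A`, and everything rests on the graph of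
`entII A` over the pure states. The entropy is continuous on states (`continuousOn_entropy`), so
this graph is compact; by Carathéodory's theorem its convex hull `roofHull` is compact too
(`isCompact_convexHull`). The fibre of the hull over `ρ` is the set of the decomposition averages,
which is why the minimum is attained (`isLeast_convexRoof`), and why the roof is convex and lower
semicontinuous.

For LOCC, outcomes are kept unnormalized: `homExt F X = tr X * F (X / tr X)` is subadditive on
positive matrices for convex `F`, so forgetting outcomes never increases it, and it suffices to
treat one local measurement on a pure state (`sum_homExt_convexRoof_le`). There the entropy of each
reduced state does not increase on average (`sum_homExt_entropy_reduced_le`): a measurement outside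
of `K` leaves the averaged reduced state on `K` unchanged, so that concavity of the entropy
(`sum_mul_entropy_le`, from Peierls' inequality) applies; a measurement inside of `K` is reduced to
this case, because both marginals of a pure state have the same entropy. The partition that is
optimal before the measurement bounds the minimum afterwards. Limits of protocols are covered by
lower semicontinuity (`isEntanglementMonotone_entOF`).

A pure state has vanishing `α`-entanglement iff its reduced states along `α` are pure, and then it
is their product, as it is fixed by the rank-one product of the projectors onto them
(`eq_tensorParts_of_reduced_mem_pureStates`). With attainment, this gives faithfulness
(`mem_sepMixedII_iff`).

For multipartite monotonicity, a larger down-set has a smaller minimum. Conversely, the product of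
Greenberger–Horne–Zeilinger states of the parts of `β` is `α`-separable only for partitions `α`
coarser than `β` (`le_of_ghzState_mem_sepPure`). If `β ∈ B` and `entOF A ≤ entOF B`, then by
faithfulness and the extremality of pure states this product is `α`-separable for some `α ∈ A`,
so that `β ∈ A`.
-/

noncomputable section

namespace PartialEnt

open Matrix
open scoped ComplexOrder Kronecker

/-! ### Entropy of positive semidefinite matrices -/

theorem posSemidef_of_mem_pureStates {ι : Type*} [Fintype ι] {π : Matrix ι ι ℂ}
    (h : π ∈ pureStates ι) : π.PosSemidef := by
  have := posSemidef_conjTranspose_mul_self π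
  rwa [h.1.eq, h.2.1] at this

section Entropy

variable {ι κ : Type*} [Fintype ι] [DecidableEq ι] [Fintype κ] [DecidableEq κ]

theorem eq_eigenvectorUnitary_mul_diagonal {ρ : Matrix ι ι ℂ} (h : ρ.IsHermitian) :
    ρ = h.eigenvectorUnitary.1 * diagonal (fun i => (h.eigenvalues i : ℂ)) *
      h.eigenvectorUnitary.1ᴴ := by
  conv_lhs => rw [h.spectral_theorem, Unitary.conjStarAlgAut_apply]
  rfl

theorem entropy_eq_sum_negMulLog {ρ : Matrix ι ι ℂ} (h : ρ.IsHermitian) :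
    entropy ρ = ∑ i, Real.negMulLog (h.eigenvalues i) := by
  have h1 : ρ * cfc Real.log ρ = Unitary.conjStarAlgAut ℂ _ h.eigenvectorUnitary
      (diagonal (fun i => ((h.eigenvalues i * Real.log (h.eigenvalues i) : ℝ) : ℂ))) := by
    rw [h.cfc_eq, IsHermitian.cfc]
    conv_lhs => enter [1]; rw [h.spectral_theorem]
    rw [← map_mul, diagonal_mul_diagonal]
    congr 2
    ext i
    simp
  rw [entropy, h1, Unitary.conjStarAlgAut_apply, Matrix.trace_mul_cycle, Unitary.coe_star_mul_self,
    one_mul, trace_diagonal, Complex.re_sum, ← Finset.sum_neg_distrib]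
  simp only [Complex.ofReal_re]
  exact Finset.sum_congr rfl fun i _ => by simp [Real.negMulLog]

/-- The entropy depends only on the characteristic polynomial. -/
theorem entropy_eq_sum_roots {ρ : Matrix ι ι ℂ} (h : ρ.IsHermitian) :
    entropy ρ = (ρ.charpoly.roots.map fun z : ℂ => Real.negMulLog z.re).sum := by
  rw [entropy_eq_sum_negMulLog h, h.roots_charpoly_eq_eigenvalues, Multiset.map_map]
  rfl

theorem entropy_transpose {ρ : Matrix ι ι ℂ} (h : ρ.IsHermitian) : entropy ρᵀ = entropy ρ := by
  rw [entropy_eq_sum_roots h, entropy_eq_sum_roots h.transpose, charpoly_transpose]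

/-- The nonzero spectra of `A Aᴴ` and `Aᴴ A` agree with multiplicities, hence so do their
entropies. -/
theorem entropy_mul_conjTranspose_comm (A : Matrix ι κ ℂ) :
    entropy (A * Aᴴ) = entropy (Aᴴ * A) := by
  have h := congrArg (fun p : Polynomial ℂ => (p.roots.map fun z : ℂ => Real.negMulLog z.re).sum)
    (charpoly_mul_comm' A Aᴴ)
  have hX : ∀ (n : ℕ) (p : Polynomial ℂ), p.Monic →
      (((Polynomial.X ^ n * p).roots).map fun z : ℂ => Real.negMulLog z.re).sum =
        (p.roots.map fun z : ℂ => Real.negMulLog z.re).sum := by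
    intro n p hp
    rw [Polynomial.roots_mul (mul_ne_zero (pow_ne_zero _ Polynomial.X_ne_zero) hp.ne_zero)]
    simp [Multiset.map_nsmul, Multiset.sum_nsmul]
  rw [hX _ _ (charpoly_monic _), hX _ _ (charpoly_monic _)] at h
  rwa [entropy_eq_sum_roots (isHermitian_mul_conjTranspose_self A),
    entropy_eq_sum_roots (isHermitian_conjTranspose_mul_self A)]

theorem sum_normSq_row_of_mul_conjTranspose_eq_one {W : Matrix ι ι ℂ} (hW : W * Wᴴ = 1) (k : ι) :
    ∑ i, Complex.normSq (W k i) = 1 := by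
  have := congrFun (congrFun hW k) k
  rw [mul_apply, one_apply_eq] at this
  have h2 := congrArg Complex.re this
  rw [Complex.re_sum] at h2
  simpa [Complex.mul_conj] using h2

theorem conj_diagonal_apply_self (W : Matrix ι ι ℂ) (l : ι → ℝ) (k : ι) :
    (W * diagonal (fun i => (l i : ℂ)) * Wᴴ) k k =
      ((∑ i, Complex.normSq (W k i) * l i : ℝ) : ℂ) := by
  rw [mul_apply, Complex.ofReal_sum]
  refine Finset.sum_congr rfl fun i _ => ?_
  rw [mul_diagonal, conjTranspose_apply, Complex.star_def, mul_right_comm, Complex.mul_conj]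
  push_cast; ring

/-- Peierls' inequality: passing to the diagonal in any orthonormal basis does not decrease the
entropy. -/
theorem entropy_le_sum_negMulLog_diag {ρ : Matrix ι ι ℂ} (h : ρ.PosSemidef) {U : Matrix ι ι ℂ}
    (hU : U * Uᴴ = 1) : entropy ρ ≤ ∑ k, Real.negMulLog ((Uᴴ * ρ * U) k k).re := by
  have hU' : Uᴴ * U = 1 := mul_eq_one_comm.mp hU
  set V : Matrix ι ι ℂ := h.1.eigenvectorUnitary.1 with hV
  have hVV : V * Vᴴ = 1 := Unitary.coe_mul_star_self h.1.eigenvectorUnitary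
  have hVV' : Vᴴ * V = 1 := mul_eq_one_comm.mp hVV
  set W := Uᴴ * V with hWdef
  have hW : W * Wᴴ = 1 := by
    rw [hWdef, conjTranspose_mul, conjTranspose_conjTranspose, Matrix.mul_assoc,
      ← Matrix.mul_assoc V, hVV, Matrix.one_mul, hU']
  have hW' : Wᴴ * Wᴴᴴ = 1 := by rw [conjTranspose_conjTranspose]; exact mul_eq_one_comm.mp hW
  have hρ : Uᴴ * ρ * U = W * diagonal (fun i => (h.1.eigenvalues i : ℂ)) * Wᴴ := by
    conv_lhs => rw [eq_eigenvectorUnitary_mul_diagonal h.1]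
    rw [hWdef, conjTranspose_mul, conjTranspose_conjTranspose]
    simp only [Matrix.mul_assoc, hV]
  rw [hρ, entropy_eq_sum_negMulLog h.1]
  calc ∑ i, Real.negMulLog (h.1.eigenvalues i)
      = ∑ i, (∑ k, Complex.normSq (W k i)) * Real.negMulLog (h.1.eigenvalues i) := by
        refine Finset.sum_congr rfl fun i _ => ?_
        have := sum_normSq_row_of_mul_conjTranspose_eq_one hW' i
        simp only [conjTranspose_apply, Complex.star_def, Complex.normSq_conj] at this
        rw [this, one_mul]
    _ = ∑ k, ∑ i, Complex.normSq (W k i) * Real.negMulLog (h.1.eigenvalues i) := by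
        simp only [Finset.sum_mul]; rw [Finset.sum_comm]
    _ ≤ _ := by
        refine Finset.sum_le_sum fun k _ => ?_
        rw [conj_diagonal_apply_self, Complex.ofReal_re]
        exact Real.concaveOn_negMulLog.le_map_sum (fun i _ => Complex.normSq_nonneg _)
          (sum_normSq_row_of_mul_conjTranspose_eq_one hW k)
          (fun i _ => h.eigenvalues_nonneg i)

/-- Concavity of the von Neumann entropy: in an eigenbasis of the mixture, the diagonals of the
constituents average to the eigenvalues of the mixture. -/
theorem sum_mul_entropy_le {α : Type*} [Fintype α] {q : α → ℝ} (hq : ∀ j, 0 ≤ q j)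
    (hq1 : ∑ j, q j = 1) {σ : α → Matrix ι ι ℂ} (hσ : ∀ j, (σ j).PosSemidef) :
    ∑ j, q j * entropy (σ j) ≤ entropy (∑ j, q j • σ j) := by
  have hρ : (∑ j, q j • σ j).PosSemidef := posSemidef_sum _ fun j _ => (hσ j).smul (hq j)
  set ρ := ∑ j, q j • σ j with hρdef
  set V : Matrix ι ι ℂ := hρ.1.eigenvectorUnitary.1 with hV
  have hVV : V * Vᴴ = 1 := Unitary.coe_mul_star_self hρ.1.eigenvectorUnitary
  have hVV' : Vᴴ * V = 1 := mul_eq_one_comm.mp hVV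
  have hdiag : ∀ k, hρ.1.eigenvalues k = ∑ j, q j * ((Vᴴ * σ j * V) k k).re := by
    intro k
    have h1 : Vᴴ * ρ * V = diagonal (fun i => (hρ.1.eigenvalues i : ℂ)) := by
      conv_lhs => rw [eq_eigenvectorUnitary_mul_diagonal hρ.1]
      rw [← hV, ← Matrix.mul_assoc, ← Matrix.mul_assoc, hVV', Matrix.one_mul, Matrix.mul_assoc,
        hVV', Matrix.mul_one]
    have h2 : Vᴴ * ρ * V = ∑ j, q j • (Vᴴ * σ j * V) := by
      rw [hρdef, Finset.mul_sum, Finset.sum_mul]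
      simp
    have h3 := congrArg Complex.re (congrFun (congrFun (h1.symm.trans h2) k) k)
    simpa [Matrix.sum_apply] using h3
  calc ∑ j, q j * entropy (σ j)
      ≤ ∑ j, q j * ∑ k, Real.negMulLog ((Vᴴ * σ j * V) k k).re :=
        Finset.sum_le_sum fun j _ => mul_le_mul_of_nonneg_left
          (entropy_le_sum_negMulLog_diag (hσ j) hVV) (hq j)
    _ = ∑ k, ∑ j, q j * Real.negMulLog ((Vᴴ * σ j * V) k k).re := by
        simp only [Finset.mul_sum]; rw [Finset.sum_comm]
    _ ≤ ∑ k, Real.negMulLog (hρ.1.eigenvalues k) := by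
        refine Finset.sum_le_sum fun k _ => ?_
        rw [hdiag k]
        refine Real.concaveOn_negMulLog.le_map_sum (fun j _ => hq j) hq1 fun j _ => ?_
        have := ((hσ j).conjTranspose_mul_mul_same V).diag_nonneg (i := k)
        exact (Complex.le_def.mp this).1
    _ = entropy ρ := (entropy_eq_sum_negMulLog hρ.1).symm

theorem sum_eigenvalues_eq_one {ρ : Matrix ι ι ℂ} (h : ρ.IsHermitian) (ht : ρ.trace = 1) :
    ∑ i, h.eigenvalues i = 1 := by
  have := h.trace_eq_sum_eigenvalues
  rw [ht] at this
  exact Complex.ofReal_injective (by simpa using this.symm)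

theorem eigenvalues_le_one {ρ : Matrix ι ι ℂ} (h : ρ.PosSemidef) (ht : ρ.trace = 1) (i : ι) :
    h.1.eigenvalues i ≤ 1 := by
  rw [← sum_eigenvalues_eq_one h.1 ht]
  exact Finset.single_le_sum (fun j _ => h.eigenvalues_nonneg j) (Finset.mem_univ i)

theorem entropy_nonneg {ρ : Matrix ι ι ℂ} (h : ρ.PosSemidef) (ht : ρ.trace = 1) :
    0 ≤ entropy ρ := by
  rw [entropy_eq_sum_negMulLog h.1]
  exact Finset.sum_nonneg fun i _ =>
    Real.negMulLog_nonneg (h.eigenvalues_nonneg i) (eigenvalues_le_one h ht i)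

theorem entropy_le_log_card {ρ : Matrix ι ι ℂ} (h : ρ.PosSemidef) (ht : ρ.trace = 1) :
    entropy ρ ≤ Real.log (Fintype.card ι) := by
  have hne : Nonempty ι := by
    by_contra hne
    rw [not_nonempty_iff] at hne
    simp [trace] at ht
  have hn : (0 : ℝ) < Fintype.card ι := by exact_mod_cast Fintype.card_pos
  rw [entropy_eq_sum_negMulLog h.1]
  have := Real.concaveOn_negMulLog.le_map_sum (t := Finset.univ)
    (w := fun _ : ι => (Fintype.card ι : ℝ)⁻¹) (p := h.1.eigenvalues)
    (fun _ _ => by positivity) (by simp [hn.ne']) (fun i _ => h.eigenvalues_nonneg i)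
  simp only [smul_eq_mul, ← Finset.mul_sum, sum_eigenvalues_eq_one h.1 ht] at this
  rw [inv_mul_le_iff₀ hn] at this
  refine this.trans_eq ?_
  rw [Real.negMulLog, Real.log_mul (by positivity) one_ne_zero]
  simp [hn.ne']

theorem entropy_eq_zero_iff {ρ : Matrix ι ι ℂ} (h : ρ.PosSemidef) (ht : ρ.trace = 1) :
    entropy ρ = 0 ↔ ρ ∈ pureStates ι := by
  rw [entropy_eq_sum_negMulLog h.1, Finset.sum_eq_zero_iff_of_nonneg fun i _ =>
    Real.negMulLog_nonneg (h.eigenvalues_nonneg i) (eigenvalues_le_one h ht i)]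
  set V : Matrix ι ι ℂ := h.1.eigenvectorUnitary.1 with hV
  have hVV : V * Vᴴ = 1 := Unitary.coe_mul_star_self h.1.eigenvectorUnitary
  have hVV' : Vᴴ * V = 1 := mul_eq_one_comm.mp hVV
  have hρ := eq_eigenvectorUnitary_mul_diagonal h.1
  rw [← hV] at hρ
  set D : Matrix ι ι ℂ := diagonal (fun i => (h.1.eigenvalues i : ℂ)) with hD
  have hρ2 : ρ * ρ = V * (D * D) * Vᴴ := by
    rw [hρ]
    calc V * D * Vᴴ * (V * D * Vᴴ) = V * D * (Vᴴ * V) * D * Vᴴ := by simp only [Matrix.mul_assoc]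
      _ = _ := by rw [hVV', Matrix.mul_one]; simp only [Matrix.mul_assoc]
  have key : ρ * ρ = ρ ↔ ∀ i, h.1.eigenvalues i * h.1.eigenvalues i = h.1.eigenvalues i := by
    constructor
    · intro hi i
      have h1 : D * D = D := by
        have h3 := congrArg (fun X => Vᴴ * X * V) (hρ2.symm.trans (hi.trans hρ))
        have h4 : ∀ X : Matrix ι ι ℂ, Vᴴ * (V * X * Vᴴ) * V = X := by
          intro X
          calc Vᴴ * (V * X * Vᴴ) * V = (Vᴴ * V) * X * (Vᴴ * V) := by simp only [Matrix.mul_assoc]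
            _ = X := by rw [hVV', Matrix.one_mul, Matrix.mul_one]
        rwa [h4, h4] at h3
      have := congrFun (congrFun h1 i) i
      simp only [hD, diagonal_mul_diagonal, diagonal_apply_eq] at this
      exact_mod_cast this
    · intro hi
      have h1 : D * D = D := by
        rw [hD, diagonal_mul_diagonal]
        congr 1
        funext i
        exact_mod_cast hi i
      rw [hρ2, h1, ← hρ]
  constructor
  · intro hz
    refine ⟨h.1, key.mpr fun i => ?_, ht⟩
    have := hz i (Finset.mem_univ i)
    rw [Real.negMulLog, mul_eq_zero, neg_eq_zero, Real.log_eq_zero] at this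
    have h0 := h.eigenvalues_nonneg i
    rcases this with h1 | h1 | h1 | h1
    · simp [h1]
    · simp [h1]
    · simp [h1]
    · linarith
  · intro hp i _
    have := key.mp hp.2.1 i
    rcases eq_or_ne (h.1.eigenvalues i) 0 with h0 | h0
    · simp [h0]
    · simp [mul_right_cancel₀ h0 (this.trans (one_mul _).symm)]

section Continuity

open scoped Matrix.Norms.L2Operator

/-- The spectra of states lie in the compact set `[0, 1]`; the isometric functional calculus of the
C⋆-algebra of matrices is continuous there. -/
theorem continuousOn_cfc_negMulLog :
    ContinuousOn (fun ρ : Matrix ι ι ℂ => cfc Real.negMulLog ρ)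
      {ρ | ρ.PosSemidef ∧ ρ.trace = 1} := by
  refine ContinuousOn.cfc' (isCompact_Icc (a := (0 : ℝ)) (b := 1)) _
    (a := fun ρ => ρ) continuousOn_id ?_ ?_ ?_
  · rintro ρ ⟨h, ht⟩
    rw [h.1.spectrum_real_eq_range_eigenvalues]
    rintro _ ⟨i, rfl⟩
    exact ⟨h.eigenvalues_nonneg i, eigenvalues_le_one h ht i⟩
  · rintro ρ ⟨h, ht⟩
    exact h.1
  · exact Real.continuous_negMulLog.continuousOn

end Continuity

/-- The entropy is continuous on states, since `x ln x` is continuous up to `x = 0`. -/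
theorem continuousOn_entropy :
    ContinuousOn (entropy (ι := ι)) {ρ | ρ.PosSemidef ∧ ρ.trace = 1} := by
  have h0 : ContinuousOn (fun ρ : Matrix ι ι ℂ => cfc Real.negMulLog ρ)
      {ρ | ρ.PosSemidef ∧ ρ.trace = 1} := continuousOn_cfc_negMulLog
  have h1 : ContinuousOn (fun ρ : Matrix ι ι ℂ => (cfc Real.negMulLog ρ).trace.re)
      {ρ | ρ.PosSemidef ∧ ρ.trace = 1} :=
    Complex.continuous_re.comp_continuousOn
      ((continuous_id.matrix_trace).comp_continuousOn h0)
  refine h1.congr ?_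
  rintro ρ ⟨h, ht⟩
  simp only
  rw [entropy_eq_sum_negMulLog h.1, h.1.cfc_eq, IsHermitian.cfc, Unitary.conjStarAlgAut_apply,
    Matrix.trace_mul_cycle, Unitary.coe_star_mul_self, one_mul, trace_diagonal, Complex.re_sum]
  simp

end Entropy

/-! ### Pure and mixed states -/

section PureMixed

variable {ι : Type*} [Fintype ι]

/-- Pure states are the rank-one projectors. -/
theorem exists_eq_vecMulVec_of_mem_pureStates {π : Matrix ι ι ℂ} (hπ : π ∈ pureStates ι) :
    ∃ ψ : ι → ℂ, π = vecMulVec ψ (star ψ) := by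
  classical
  have h := posSemidef_of_mem_pureStates hπ
  have hz := (entropy_eq_zero_iff h hπ.2.2).mpr hπ
  rw [entropy_eq_sum_negMulLog h.1, Finset.sum_eq_zero_iff_of_nonneg fun i _ =>
    Real.negMulLog_nonneg (h.eigenvalues_nonneg i) (eigenvalues_le_one h hπ.2.2 i)] at hz
  have hsum := sum_eigenvalues_eq_one h.1 hπ.2.2
  obtain ⟨i, hi⟩ : ∃ i, h.1.eigenvalues i ≠ 0 := by
    by_contra! hall
    simp [hall] at hsum
  have hi1 : h.1.eigenvalues i = 1 := by
    have := hz i (Finset.mem_univ i)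
    have h0 := h.eigenvalues_nonneg i
    rw [Real.negMulLog, mul_eq_zero, neg_eq_zero, Real.log_eq_zero] at this
    rcases this with h1 | h1 | h1 | h1
    · exact absurd h1 hi
    · exact absurd h1 hi
    · exact h1
    · linarith
  have hj : ∀ j, j ≠ i → h.1.eigenvalues j = 0 := by
    rw [← Finset.add_sum_erase _ _ (Finset.mem_univ i), hi1, add_eq_left,
      Finset.sum_eq_zero_iff_of_nonneg fun j _ => h.eigenvalues_nonneg j] at hsum
    exact fun j hji => hsum j (by simp [hji])
  refine ⟨fun x => h.1.eigenvectorUnitary.1 x i, ?_⟩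
  conv_lhs => rw [eq_eigenvectorUnitary_mul_diagonal h.1]
  ext x y
  rw [mul_apply, Finset.sum_eq_single i]
  · simp [mul_diagonal, hi1, vecMulVec_apply]
  · intro j _ hji
    simp [mul_diagonal, hj j hji]
  · simp

theorem vecMulVec_mem_pureStates {ψ : ι → ℂ} (h : star ψ ⬝ᵥ ψ = 1) :
    vecMulVec ψ (star ψ) ∈ pureStates ι := by
  refine ⟨(posSemidef_vecMulVec_self_star ψ).1, ?_, ?_⟩
  · rw [vecMulVec_mul_vecMulVec, h, one_smul]
  · rw [trace_vecMulVec, dotProduct_comm, h]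

/-- The mixed states are the positive semidefinite matrices of unit trace. -/
theorem mem_mixedStates_iff {ρ : Matrix ι ι ℂ} :
    ρ ∈ mixedStates ι ↔ ρ.PosSemidef ∧ ρ.trace = 1 := by
  constructor
  · intro h
    have hc : Convex ℝ {ρ : Matrix ι ι ℂ | ρ.PosSemidef ∧ ρ.trace = 1} := by
      rintro x ⟨hx, hx1⟩ y ⟨hy, hy1⟩ a b ha hb hab
      refine ⟨(hx.smul ha).add (hy.smul hb), ?_⟩
      rw [trace_add, trace_smul, trace_smul, hx1, hy1, ← add_smul, hab, one_smul]
    exact convexHull_min (t := {ρ : Matrix ι ι ℂ | ρ.PosSemidef ∧ ρ.trace = 1})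
      (fun π hπ => And.intro (posSemidef_of_mem_pureStates hπ) hπ.2.2) hc h
  · classical
    rintro ⟨h, ht⟩
    have hV : h.1.eigenvectorUnitary.1ᴴ * h.1.eigenvectorUnitary.1 = 1 :=
      Unitary.coe_star_mul_self h.1.eigenvectorUnitary
    refine mem_convexHull_of_exists_fintype h.1.eigenvalues
      (fun i => vecMulVec (fun x => h.1.eigenvectorUnitary.1 x i)
        (star fun x => h.1.eigenvectorUnitary.1 x i))
      h.eigenvalues_nonneg (sum_eigenvalues_eq_one h.1 ht) (fun i => ?_) ?_
    · refine vecMulVec_mem_pureStates ?_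
      have := congrFun (congrFun hV i) i
      rwa [mul_apply, one_apply_eq] at this
    · conv_rhs => rw [eq_eigenvectorUnitary_mul_diagonal h.1]
      ext x y
      rw [Matrix.sum_apply, mul_apply]
      refine Finset.sum_congr rfl fun i _ => ?_
      simp [mul_diagonal, vecMulVec_apply]
      ring

theorem pureStates_subset_mixedStates : pureStates ι ⊆ mixedStates ι :=
  subset_convexHull ℝ _

theorem isCompact_pureStates : IsCompact (pureStates ι) := by
  have hcl : IsClosed (pureStates ι) := by
    refine IsClosed.inter (isClosed_eq (by fun_prop) continuous_id)
      (IsClosed.inter (isClosed_eq (by fun_prop) continuous_id)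
        (isClosed_eq (by fun_prop) continuous_const))
  refine IsCompact.of_isClosed_subset (isCompact_univ_pi fun _ : ι => isCompact_univ_pi
    fun _ : ι => isCompact_closedBall (0 : ℂ) 1) hcl fun π hπ => ?_
  refine fun i _ j _ => mem_closedBall_zero_iff.mpr ?_
  -- `‖π i j‖ ^ 2` is one of the summands of `tr (π πᴴ) = tr π = 1`.
  have h1 : (π * πᴴ).trace = 1 := by rw [hπ.1.eq, hπ.2.1, hπ.2.2]
  have h2 : ∑ i, ∑ j, ‖π i j‖ ^ 2 = 1 := by
    have h3 := congrArg Complex.re h1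
    simp only [trace, diag_apply, mul_apply, conjTranspose_apply, Complex.re_sum,
      Complex.star_def, Complex.mul_conj, Complex.ofReal_re, Complex.normSq_eq_norm_sq,
      Complex.one_re] at h3
    exact h3
  have h4 : ‖π i j‖ ^ 2 ≤ 1 := by
    rw [← h2]
    refine (Finset.single_le_sum (f := fun j => ‖π i j‖ ^ 2) (fun _ _ => by positivity)
      (Finset.mem_univ j)).trans (Finset.single_le_sum (f := fun i => ∑ j, ‖π i j‖ ^ 2)
      (fun _ _ => by positivity) (Finset.mem_univ i))
  nlinarith [norm_nonneg (π i j)]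

end PureMixed

/-! ### Convex roofs -/

/-- By Carathéodory's theorem the convex hull of `s` is the image of `Δ × sⁿ⁺¹`, where `Δ` is the
standard simplex and `n` is the dimension. -/
theorem isCompact_convexHull {E : Type*} [AddCommGroup E] [Module ℝ E] [TopologicalSpace E]
    [ContinuousAdd E] [ContinuousSMul ℝ E] [FiniteDimensional ℝ E] {s : Set E}
    (hs : IsCompact s) : IsCompact (convexHull ℝ s) := by
  rcases s.eq_empty_or_nonempty with rfl | ⟨s₀, hs₀⟩
  · simp
  let n := Module.finrank ℝ E + 1
  have hK : IsCompact (stdSimplex ℝ (Fin n) ×ˢ (Set.univ.pi fun _ : Fin n => s)) :=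
    (isCompact_stdSimplex ℝ _).prod (isCompact_univ_pi fun _ => hs)
  have hcont : Continuous fun p : (Fin n → ℝ) × (Fin n → E) => ∑ i, p.1 i • p.2 i := by fun_prop
  convert hK.image hcont using 1
  apply Set.Subset.antisymm
  · intro x hx
    obtain ⟨ι, _, z, w, hz, hind, hw, hw1, hx⟩ := eq_pos_convex_span_of_mem_convexHull hx
    have hcard : Fintype.card ι ≤ Fintype.card (Fin n) := by
      rw [Fintype.card_fin]
      exact hind.card_le_finrank_succ.trans (Nat.succ_le_succ (Submodule.finrank_le _))
    obtain ⟨e⟩ := Function.Embedding.nonempty_of_card_le hcard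
    refine ⟨(Function.extend e w 0, Function.extend e z fun _ => s₀), ⟨⟨fun i => ?_, ?_⟩, ?_⟩, ?_⟩
    · by_cases h : ∃ j, e j = i
      · obtain ⟨j, rfl⟩ := h
        simpa [e.injective.extend_apply] using (hw j).le
      · simp [Function.extend_apply' _ _ _ h]
    · rw [← hw1]
      refine (Fintype.sum_of_injective e e.injective _ _ (fun i hi => ?_) fun j => ?_).symm
      · simp [Function.extend_apply' _ _ _ hi]
      · simp [e.injective.extend_apply]
    · intro i _
      by_cases h : ∃ j, e j = i
      · obtain ⟨j, rfl⟩ := h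
        simpa [e.injective.extend_apply] using hz ⟨j, rfl⟩
      · simpa [Function.extend_apply' _ _ _ h] using hs₀
    · rw [← hx]
      refine (Fintype.sum_of_injective e e.injective _ _ (fun i hi => ?_) fun j => ?_).symm
      · simp [Function.extend_apply' _ _ _ hi]
      · simp [e.injective.extend_apply]
  · rintro _ ⟨⟨w, z⟩, ⟨⟨hw, hw1⟩, hz⟩, rfl⟩
    exact mem_convexHull_of_exists_fintype w z hw hw1 (fun i => hz i (Set.mem_univ i)) rfl

section Roof

variable {ι : Type*} [Fintype ι] {f : Matrix ι ι ℂ → ℝ}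

/-- The convex hull of the graph of `f` over the pure states. Its fibre over `ρ` is the set of the
averages of `f` over the pure state decompositions of `ρ`. -/
def roofHull (f : Matrix ι ι ℂ → ℝ) : Set (Matrix ι ι ℂ × ℝ) :=
  convexHull ℝ ((fun π => (π, f π)) '' pureStates ι)

theorem mem_roofValues_iff {ρ : Matrix ι ι ℂ} {t : ℝ} :
    t ∈ roofValues f ρ ↔ (ρ, t) ∈ roofHull f := by
  constructor
  · rintro ⟨m, p, π, hp, hp1, hπ, rfl, rfl⟩
    refine mem_convexHull_of_exists_fintype p (fun i => (π i, f (π i))) hp hp1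
      (fun i => ⟨π i, hπ i, rfl⟩) ?_
    ext1 <;> simp [Prod.fst_sum, Prod.snd_sum]
  · intro h
    obtain ⟨α, _, w, z, hw, hw1, hz, hx⟩ := mem_convexHull_iff_exists_fintype.mp h
    choose π hπ hπz using hz
    let e := Fintype.equivFin α
    refine ⟨Fintype.card α, w ∘ e.symm, π ∘ e.symm, fun i => hw _, ?_, fun i => hπ _, ?_, ?_⟩
    · rw [← hw1]; exact e.symm.sum_comp w
    · have := congrArg Prod.fst hx
      simp only [← hπz, Prod.fst_sum, Prod.smul_fst] at this
      rw [← this]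
      exact e.symm.sum_comp fun i => w i • π i
    · have := congrArg Prod.snd hx
      simp only [← hπz, Prod.snd_sum, Prod.smul_snd, smul_eq_mul] at this
      rw [← this]
      exact (e.symm.sum_comp fun i => w i * f (π i)).symm

theorem isCompact_roofHull (hf : ContinuousOn f (pureStates ι)) : IsCompact (roofHull f) :=
  isCompact_convexHull (isCompact_pureStates.image_of_continuousOn (continuousOn_id.prodMk hf))

theorem roofValues_nonempty {ρ : Matrix ι ι ℂ} (hρ : ρ ∈ mixedStates ι) :
    (roofValues f ρ).Nonempty := by
  obtain ⟨α, _, w, z, hw, hw1, hz, hx⟩ := mem_convexHull_iff_exists_fintype.mp hρ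
  refine ⟨∑ i, w i * f (z i), mem_roofValues_iff.mpr ?_⟩
  refine mem_convexHull_of_exists_fintype w (fun i => (z i, f (z i))) hw hw1
    (fun i => ⟨z i, hz i, rfl⟩) ?_
  rw [← hx]
  ext1 <;> simp [Prod.fst_sum, Prod.snd_sum]

theorem isLeast_convexRoof (hf : ContinuousOn f (pureStates ι)) {ρ : Matrix ι ι ℂ}
    (hρ : ρ ∈ mixedStates ι) : IsLeast (roofValues f ρ) (convexRoof f ρ) := by
  have hc : IsCompact (roofValues f ρ) := by
    have h1 : IsCompact (roofHull f ∩ Prod.fst ⁻¹' {ρ}) :=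
      (isCompact_roofHull hf).inter_right (isClosed_singleton.preimage continuous_fst)
    convert h1.image continuous_snd using 1
    ext t
    rw [mem_roofValues_iff]
    simp
  exact hc.isLeast_sInf (roofValues_nonempty hρ)

theorem convexRoof_le (hf : ContinuousOn f (pureStates ι)) {ρ : Matrix ι ι ℂ} {t : ℝ}
    (hρ : ρ ∈ mixedStates ι) (h : (ρ, t) ∈ roofHull f) : convexRoof f ρ ≤ t :=
  (isLeast_convexRoof hf hρ).2 (mem_roofValues_iff.mpr h)

theorem convexRoof_mem_roofHull (hf : ContinuousOn f (pureStates ι)) {ρ : Matrix ι ι ℂ}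
    (hρ : ρ ∈ mixedStates ι) : (ρ, convexRoof f ρ) ∈ roofHull f :=
  mem_roofValues_iff.mp (isLeast_convexRoof hf hρ).1

theorem convexRoof_le_of_mem_pureStates (hf : ContinuousOn f (pureStates ι)) {π : Matrix ι ι ℂ}
    (hπ : π ∈ pureStates ι) : convexRoof f π ≤ f π :=
  convexRoof_le hf (pureStates_subset_mixedStates hπ) (subset_convexHull ℝ _ ⟨π, hπ, rfl⟩)

theorem convexOn_convexRoof (hf : ContinuousOn f (pureStates ι)) :
    ConvexOn ℝ (mixedStates ι) (convexRoof f) := by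
  refine ⟨convex_convexHull ℝ _, fun x hx y hy a b ha hb hab => ?_⟩
  exact convexRoof_le hf (convex_convexHull ℝ _ hx hy ha hb hab)
    (convex_convexHull ℝ _ (convexRoof_mem_roofHull hf hx) (convexRoof_mem_roofHull hf hy)
      ha hb hab)

theorem lowerSemicontinuousOn_convexRoof (hf : ContinuousOn f (pureStates ι)) :
    LowerSemicontinuousOn (convexRoof f) (mixedStates ι) := by
  intro ρ hρ c hc
  -- The sublevel set of `c` is the projection of a compact part of the hull of the graph.
  have h1 : IsCompact (Prod.fst '' (roofHull f ∩ Prod.snd ⁻¹' Set.Iic c)) :=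
    ((isCompact_roofHull hf).inter_right (isClosed_Iic.preimage continuous_snd)).image
      continuous_fst
  have h2 : ρ ∈ (Prod.fst '' (roofHull f ∩ Prod.snd ⁻¹' Set.Iic c))ᶜ := by
    rintro ⟨⟨_, t⟩, ⟨ht, htc⟩, rfl⟩
    exact absurd ((convexRoof_le hf hρ ht).trans htc) (not_le.mpr hc)
  filter_upwards [mem_nhdsWithin_of_mem_nhds (h1.isClosed.isOpen_compl.mem_nhds h2),
    self_mem_nhdsWithin] with σ hσ hσm
  by_contra hcon
  exact hσ ⟨(σ, convexRoof f σ), ⟨convexRoof_mem_roofHull hf hσm, not_lt.mp hcon⟩, rfl⟩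

/-! ### The homogeneous extension of a convex function of states to the positive cone -/

/-- The positively homogeneous extension of a function of states: the contribution `p * F ρ` of an
unnormalized outcome `p • ρ` of probability `p` to an average. -/
def homExt (F : Matrix ι ι ℂ → ℝ) (X : Matrix ι ι ℂ) : ℝ :=
  X.trace.re * F (X.trace.re⁻¹ • X)

theorem trace_eq_ofReal_re {X : Matrix ι ι ℂ} (hX : X.PosSemidef) :
    X.trace = (X.trace.re : ℂ) := by
  have := (Complex.le_def.mp hX.trace_nonneg).2
  exact Complex.ext rfl (by simpa using this.symm)

theorem re_trace_nonneg {X : Matrix ι ι ℂ} (hX : X.PosSemidef) : 0 ≤ X.trace.re :=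
  (Complex.le_def.mp hX.trace_nonneg).1

theorem eq_zero_of_re_trace_eq_zero {X : Matrix ι ι ℂ} (hX : X.PosSemidef)
    (h : X.trace.re = 0) : X = 0 := by
  rw [← hX.trace_eq_zero_iff, trace_eq_ofReal_re hX, h, Complex.ofReal_zero]

theorem inv_re_trace_smul_mem_mixedStates {X : Matrix ι ι ℂ} (hX : X.PosSemidef)
    (h : X.trace.re ≠ 0) : X.trace.re⁻¹ • X ∈ mixedStates ι := by
  refine mem_mixedStates_iff.mpr ⟨hX.smul (inv_nonneg.mpr (re_trace_nonneg hX)), ?_⟩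
  rw [trace_smul, trace_eq_ofReal_re hX, Complex.ofReal_re, Complex.real_smul,
    ← Complex.ofReal_mul, inv_mul_cancel₀ h, Complex.ofReal_one]

variable {F : Matrix ι ι ℂ → ℝ}

@[simp] theorem homExt_zero : homExt F 0 = 0 := by simp [homExt]

theorem homExt_of_trace_eq_one {X : Matrix ι ι ℂ} (h : X.trace = 1) : homExt F X = F X := by
  simp [homExt, h]

theorem homExt_smul {c : ℝ} (X : Matrix ι ι ℂ) : homExt F (c • X) = c * homExt F X := by
  rcases eq_or_ne c 0 with rfl | hc
  · simp
  · have h1 : (c • X).trace.re = c * X.trace.re := by simp [trace_smul]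
    rw [homExt, homExt, h1, smul_smul, mul_inv, mul_assoc, mul_assoc c⁻¹,
      mul_comm (X.trace.re)⁻¹ c, ← mul_assoc c⁻¹, inv_mul_cancel₀ hc, one_mul]

theorem homExt_nonneg (hF : ∀ ρ ∈ mixedStates ι, 0 ≤ F ρ) {X : Matrix ι ι ℂ}
    (hX : X.PosSemidef) : 0 ≤ homExt F X := by
  rcases eq_or_ne X.trace.re 0 with h | h
  · simp [homExt, h]
  · exact mul_nonneg (re_trace_nonneg hX) (hF _ (inv_re_trace_smul_mem_mixedStates hX h))

theorem homExt_add_le (hF : ConvexOn ℝ (mixedStates ι) F) {X Y : Matrix ι ι ℂ}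
    (hX : X.PosSemidef) (hY : Y.PosSemidef) : homExt F (X + Y) ≤ homExt F X + homExt F Y := by
  rcases eq_or_ne X.trace.re 0 with hx | hx
  · simp [eq_zero_of_re_trace_eq_zero hX hx]
  rcases eq_or_ne Y.trace.re 0 with hy | hy
  · simp [eq_zero_of_re_trace_eq_zero hY hy]
  have hx0 := (re_trace_nonneg hX).lt_of_ne' hx
  have hy0 := (re_trace_nonneg hY).lt_of_ne' hy
  have hxy : (X + Y).trace.re = X.trace.re + Y.trace.re := by simp [trace_add]
  simp only [homExt, hxy]
  set x := X.trace.re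
  set y := Y.trace.re
  have ha : 0 ≤ x / (x + y) := by positivity
  have hb : 0 ≤ y / (x + y) := by positivity
  have hab : x / (x + y) + y / (x + y) = 1 := by field_simp
  have h := hF.2 (inv_re_trace_smul_mem_mixedStates hX hx)
    (inv_re_trace_smul_mem_mixedStates hY hy) ha hb hab
  have h2 : (x / (x + y)) • x⁻¹ • X + (y / (x + y)) • y⁻¹ • Y = (x + y)⁻¹ • (X + Y) := by
    rw [smul_smul, smul_smul, smul_add]
    congr 2 <;> field_simp
  rw [h2, smul_eq_mul, smul_eq_mul] at h
  calc (x + y) * F ((x + y)⁻¹ • (X + Y))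
      ≤ (x + y) * (x / (x + y) * F (x⁻¹ • X) + y / (x + y) * F (y⁻¹ • Y)) :=
        mul_le_mul_of_nonneg_left h (by positivity)
    _ = _ := by field_simp

theorem homExt_sum_le (hF : ConvexOn ℝ (mixedStates ι) F) {α : Type*} (s : Finset α)
    {X : α → Matrix ι ι ℂ} (hX : ∀ i, (X i).PosSemidef) :
    homExt F (∑ i ∈ s, X i) ≤ ∑ i ∈ s, homExt F (X i) := by
  classical
  induction s using Finset.induction_on with
  | empty => simp
  | insert a s ha ih =>
    rw [Finset.sum_insert ha, Finset.sum_insert ha]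
    exact (homExt_add_le hF (hX a) (posSemidef_sum _ fun i _ => hX i)).trans
      (add_le_add le_rfl ih)

theorem lowerSemicontinuousOn_homExt (hF : LowerSemicontinuousOn F (mixedStates ι))
    (hF0 : ∀ ρ ∈ mixedStates ι, 0 ≤ F ρ) :
    LowerSemicontinuousOn (homExt F) {X | X.PosSemidef} := by
  intro X hX y hy
  have hX' : X.PosSemidef := hX
  rcases eq_or_ne X.trace.re 0 with hx | hx
  · have hy0 : y < 0 := by simpa [homExt, hx] using hy
    filter_upwards [self_mem_nhdsWithin] with Y hY
    exact hy0.trans_le (homExt_nonneg hF0 hY)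
  have hx0 := (re_trace_nonneg hX').lt_of_ne' hx
  have htr : Continuous fun Y : Matrix ι ι ℂ => Y.trace.re :=
    Complex.continuous_re.comp continuous_id.matrix_trace
  have hy' : y / X.trace.re < F (X.trace.re⁻¹ • X) := by
    rw [div_lt_iff₀ hx0, mul_comm]; exact hy
  obtain ⟨c, hyc, hc⟩ := exists_between hy'
  rw [div_lt_iff₀ hx0] at hyc
  have hnorm : Tendsto (fun Y : Matrix ι ι ℂ => Y.trace.re⁻¹ • Y) (𝓝[{X | X.PosSemidef}] X)
      (𝓝[mixedStates ι] (X.trace.re⁻¹ • X)) := by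
    refine tendsto_nhdsWithin_iff.mpr ⟨?_, ?_⟩
    · exact (((htr.tendsto X).inv₀ hx).smul tendsto_id).mono_left nhdsWithin_le_nhds
    · filter_upwards [self_mem_nhdsWithin,
        mem_nhdsWithin_of_mem_nhds (htr.continuousAt.eventually_ne hx)] with Y hY hY0
      exact inv_re_trace_smul_mem_mixedStates hY hY0
  filter_upwards [hnorm.eventually (hF _ (inv_re_trace_smul_mem_mixedStates hX' hx) c hc),
    mem_nhdsWithin_of_mem_nhds (htr.continuousAt.eventually (lt_mem_nhds hx0)),
    mem_nhdsWithin_of_mem_nhds ((htr.const_mul c).continuousAt.eventually (lt_mem_nhds hyc))]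
    with Y h1 h2 h3
  exact h3.trans (by rw [mul_comm]; exact mul_lt_mul_of_pos_left h1 h2)

/-- A convex roof is determined by the pure states: a family of linear maps preserving positivity
does not increase the average of the roof if it does not increase it on pure states. -/
theorem sum_homExt_convexRoof_le (hf : ContinuousOn f (pureStates ι)) {k : ℕ}
    (T : Fin k → Matrix ι ι ℂ →ₗ[ℝ] Matrix ι ι ℂ)
    (hT : ∀ j X, X.PosSemidef → (T j X).PosSemidef)
    (hpure : ∀ π ∈ pureStates ι, ∑ j, homExt (convexRoof f) (T j π) ≤ f π)
    {X : Matrix ι ι ℂ} (hX : X.PosSemidef) :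
    ∑ j, homExt (convexRoof f) (T j X) ≤ homExt (convexRoof f) X := by
  have key : ∀ ρ ∈ mixedStates ι, ∑ j, homExt (convexRoof f) (T j ρ) ≤ convexRoof f ρ := by
    intro ρ hρ
    obtain ⟨m, p, π, hp, hp1, hπ, hρπ, ht⟩ := (isLeast_convexRoof hf hρ).1
    rw [ht]
    calc ∑ j, homExt (convexRoof f) (T j ρ)
        ≤ ∑ j, ∑ i, p i * homExt (convexRoof f) (T j (π i)) := by
          refine Finset.sum_le_sum fun j _ => ?_
          rw [← hρπ, map_sum]
          refine (homExt_sum_le (convexOn_convexRoof hf) _ fun i => ?_).trans_eq ?_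
          · exact hT j _ ((posSemidef_of_mem_pureStates (hπ i)).smul (hp i))
          · simp only [map_smul, homExt_smul]
      _ = ∑ i, p i * ∑ j, homExt (convexRoof f) (T j (π i)) := by
          simp only [Finset.mul_sum]; rw [Finset.sum_comm]
      _ ≤ ∑ i, p i * f (π i) :=
          Finset.sum_le_sum fun i _ => mul_le_mul_of_nonneg_left (hpure _ (hπ i)) (hp i)
  rcases eq_or_ne X.trace.re 0 with hx | hx
  · simp [eq_zero_of_re_trace_eq_zero hX hx]
  have h1 := key _ (inv_re_trace_smul_mem_mixedStates hX hx)
  have h2 : X = X.trace.re • (X.trace.re⁻¹ • X) := by rw [smul_smul, mul_inv_cancel₀ hx, one_smul]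
  calc ∑ j, homExt (convexRoof f) (T j X)
      = X.trace.re * ∑ j, homExt (convexRoof f) (T j (X.trace.re⁻¹ • X)) := by
        rw [Finset.mul_sum]
        refine Finset.sum_congr rfl fun j _ => ?_
        conv_lhs => rw [h2]
        rw [map_smul, homExt_smul]
    _ ≤ _ := mul_le_mul_of_nonneg_left h1 (re_trace_nonneg hX)

end Roof

/-! ### Pure states and projectors -/

section PureStates

variable {ι κ : Type*} [Fintype ι] [Fintype κ]

theorem submatrix_equiv_mem_pureStates (e : κ ≃ ι) {π : Matrix ι ι ℂ} (hπ : π ∈ pureStates ι) :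
    π.submatrix e e ∈ pureStates κ := by
  refine ⟨hπ.1.submatrix e, ?_, ?_⟩
  · rw [submatrix_mul_equiv, hπ.2.1]
  · rw [← hπ.2.2]
    exact e.sum_comp fun i => π i i

/-- A measurement operator maps a pure state to a pure state, up to normalization. -/
theorem inv_smul_conj_mem_pureStates {π : Matrix ι ι ℂ} (hπ : π ∈ pureStates ι)
    (A : Matrix ι ι ℂ) (h : (A * π * Aᴴ).trace.re ≠ 0) :
    (A * π * Aᴴ).trace.re⁻¹ • (A * π * Aᴴ) ∈ pureStates ι := by
  classical
  have hY : (A * π * Aᴴ).PosSemidef :=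
    (posSemidef_of_mem_pureStates hπ).mul_mul_conjTranspose_same A
  obtain ⟨hS, ht⟩ := mem_mixedStates_iff.mp (inv_re_trace_smul_mem_mixedStates hY h)
  refine ⟨hS.1, ?_, ht⟩
  obtain ⟨ψ, hψ⟩ := exists_eq_vecMulVec_of_mem_pureStates hπ
  have hv : A * π * Aᴴ = vecMulVec (A *ᵥ ψ) (star (A *ᵥ ψ)) := by
    rw [hψ, mul_vecMulVec, vecMulVec_mul, star_mulVec]
  have htr : star (A *ᵥ ψ) ⬝ᵥ (A *ᵥ ψ) = ((A * π * Aᴴ).trace.re : ℂ) := by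
    rw [← trace_eq_ofReal_re hY, hv, trace_vecMulVec, dotProduct_comm]
  set q := (A * π * Aᴴ).trace.re
  rw [hv, smul_mul_smul_comm, vecMulVec_mul_vecMulVec, htr]
  ext x y
  simp only [Matrix.smul_apply, Complex.real_smul, smul_eq_mul, vecMulVec_apply, Pi.smul_apply]
  have : (q : ℂ) ≠ 0 := by exact_mod_cast h
  push_cast
  field_simp

/-- A projector that has expectation one in a pure state fixes it. -/
theorem mul_eq_self_of_trace_eq_one {P π : Matrix ι ι ℂ} (hP : P.IsHermitian) (hPP : P * P = P)
    (hπ : π ∈ pureStates ι) (h : (P * π).trace = 1) : P * π = π := by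
  have h0 : ((π - P * π) * (π - P * π)ᴴ).trace = 0 := by
    have h1 : (π - P * π) * (π - P * π)ᴴ = π - P * π - π * P + P * π * P := by
      rw [conjTranspose_sub, conjTranspose_mul, hP.eq, hπ.1.eq, Matrix.sub_mul, Matrix.mul_sub,
        Matrix.mul_sub, ← Matrix.mul_assoc π π P, hπ.2.1, Matrix.mul_assoc P π π, hπ.2.1,
        ← Matrix.mul_assoc (P * π) π P, Matrix.mul_assoc P π π, hπ.2.1]
      abel
    have h2 : (P * π * P).trace = 1 := by
      rw [trace_mul_comm, ← Matrix.mul_assoc, hPP, h]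
    rw [h1, trace_add, trace_sub, trace_sub, trace_mul_comm π P, h2, h, hπ.2.2]
    ring
  exact (sub_eq_zero.mp (trace_mul_conjTranspose_self_eq_zero_iff.mp h0)).symm

theorem eq_of_trace_mul_eq_one {P π : Matrix ι ι ℂ} (hP : P ∈ pureStates ι)
    (hπ : π ∈ pureStates ι) (h : (P * π).trace = 1) : P = π := by
  have h1 := mul_eq_self_of_trace_eq_one hP.1 hP.2.1 hπ h
  have h2 := mul_eq_self_of_trace_eq_one hπ.1 hπ.2.1 hP (by rw [trace_mul_comm, h])
  have h3 := congrArg conjTranspose h1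
  rw [conjTranspose_mul, hπ.1.eq, hP.1.eq, h2] at h3
  exact h3

/-- The overlap of pure states is at most one, as `0 ≤ tr (P - π)² = 2 - 2 tr (P π)`. -/
theorem re_trace_mul_le_one {P π : Matrix ι ι ℂ} (hP : P ∈ pureStates ι)
    (hπ : π ∈ pureStates ι) : (P * π).trace.re ≤ 1 := by
  have h1 : 0 ≤ ((P - π) * (P - π)ᴴ).trace.re := by
    exact (Complex.le_def.mp (posSemidef_self_mul_conjTranspose (P - π)).trace_nonneg).1
  have h2 : (P - π) * (P - π)ᴴ = P - P * π - π * P + π := by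
    rw [conjTranspose_sub, hP.1.eq, hπ.1.eq, Matrix.sub_mul, Matrix.mul_sub, Matrix.mul_sub,
      hP.2.1, hπ.2.1]
    abel
  rw [h2, trace_add, trace_sub, trace_sub, trace_mul_comm π P, hP.2.2, hπ.2.2] at h1
  simp at h1
  linarith

theorem trace_mul_eq_ofReal_re {P π : Matrix ι ι ℂ} (hP : P ∈ pureStates ι)
    (hπ : π ∈ pureStates ι) : (P * π).trace = ((P * π).trace.re : ℂ) := by
  have h1 : (P * π).trace = (P * π * Pᴴ).trace := by
    rw [hP.1.eq, trace_mul_comm (P * π), ← Matrix.mul_assoc, hP.2.1]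
  rw [h1]
  exact trace_eq_ofReal_re ((posSemidef_of_mem_pureStates hπ).mul_mul_conjTranspose_same P)

/-- Pure states are extreme: the functional `tr (π ·)` exposes `π` among the states. -/
theorem mem_of_mem_convexHull_of_mem_pureStates {s : Set (Matrix ι ι ℂ)}
    (hs : s ⊆ pureStates ι) {π : Matrix ι ι ℂ} (hπ : π ∈ pureStates ι)
    (h : π ∈ convexHull ℝ s) : π ∈ s := by
  by_contra hcon
  have hconv : Convex ℝ {X : Matrix ι ι ℂ | (π * X).trace.re < 1} := by
    intro X hX Y hY a b ha hb hab
    simp only [Set.mem_ofPred_eq] at hX hY ⊢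
    have : (π * (a • X + b • Y)).trace.re = a * (π * X).trace.re + b * (π * Y).trace.re := by
      simp [Matrix.mul_add, trace_add, trace_smul]
    rw [this]
    exact (convex_Iio (1 : ℝ)) hX hY ha hb hab
  have hlt : s ⊆ {X : Matrix ι ι ℂ | (π * X).trace.re < 1} := by
    intro σ hσ
    refine lt_of_le_of_ne (re_trace_mul_le_one hπ (hs hσ)) fun h1 => hcon ?_
    rwa [eq_of_trace_mul_eq_one hπ (hs hσ) (by
      rw [trace_mul_eq_ofReal_re hπ (hs hσ), h1, Complex.ofReal_one])]
  have h1 : (π * π).trace.re < 1 := convexHull_min hlt hconv h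
  rw [hπ.2.1, hπ.2.2] at h1
  simp at h1

end PureStates

/-! ### Partial traces of bipartite systems -/

section Bipartite

variable {m n : Type*} [Fintype m] [Fintype n]

/-- The partial trace over the second factor. -/
def traceRight (X : Matrix (m × n) (m × n) ℂ) : Matrix m m ℂ :=
  Matrix.of fun x y => ∑ z, X (x, z) (y, z)

/-- The partial trace over the first factor. -/
def traceLeft (X : Matrix (m × n) (m × n) ℂ) : Matrix n n ℂ :=
  Matrix.of fun x y => ∑ z, X (z, x) (z, y)

theorem trace_traceRight (X : Matrix (m × n) (m × n) ℂ) : (traceRight X).trace = X.trace := by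
  simp [trace, traceRight, Fintype.sum_prod_type]

theorem trace_traceLeft (X : Matrix (m × n) (m × n) ℂ) : (traceLeft X).trace = X.trace := by
  simp [trace, traceLeft, Fintype.sum_prod_type_right]

omit [Fintype m] in
theorem traceRight_smul (c : ℝ) (X : Matrix (m × n) (m × n) ℂ) :
    traceRight (c • X) = c • traceRight X := by
  ext x y
  simp [traceRight, Finset.mul_sum]

omit [Fintype n] in
theorem traceLeft_smul (c : ℝ) (X : Matrix (m × n) (m × n) ℂ) :
    traceLeft (c • X) = c • traceLeft X := by
  ext x y
  simp [traceLeft, Finset.mul_sum]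

omit [Fintype m] in
theorem posSemidef_traceRight {X : Matrix (m × n) (m × n) ℂ} (hX : X.PosSemidef) :
    (traceRight X).PosSemidef := by
  have : traceRight X = ∑ z, X.submatrix (fun x => (x, z)) (fun x => (x, z)) := by
    ext x y
    simp [traceRight, Matrix.sum_apply]
  rw [this]
  exact posSemidef_sum _ fun z _ => hX.submatrix _

omit [Fintype n] in
theorem posSemidef_traceLeft {X : Matrix (m × n) (m × n) ℂ} (hX : X.PosSemidef) :
    (traceLeft X).PosSemidef := by
  have : traceLeft X = ∑ z, X.submatrix (fun x => (z, x)) (fun x => (z, x)) := by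
    ext x y
    simp [traceLeft, Matrix.sum_apply]
  rw [this]
  exact posSemidef_sum _ fun z _ => hX.submatrix _

variable [DecidableEq m] [DecidableEq n]

omit [DecidableEq m] in
theorem trace_mul_kronecker_one (N : Matrix m m ℂ) (X : Matrix (m × n) (m × n) ℂ) :
    (X * (N ⊗ₖ (1 : Matrix n n ℂ))).trace = (traceRight X * N).trace := by
  simp only [trace, diag_apply, mul_apply, Fintype.sum_prod_type, kroneckerMap_apply,
    traceRight, of_apply, one_apply, mul_ite, mul_one, mul_zero, Finset.sum_ite_eq',
    Finset.mem_univ, if_true, Finset.sum_mul]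
  refine Finset.sum_congr rfl fun x _ => ?_
  rw [Finset.sum_comm]

omit [DecidableEq n] in
theorem trace_mul_one_kronecker (N : Matrix n n ℂ) (X : Matrix (m × n) (m × n) ℂ) :
    (X * ((1 : Matrix m m ℂ) ⊗ₖ N)).trace = (traceLeft X * N).trace := by
  have h1 : (X * ((1 : Matrix m m ℂ) ⊗ₖ N)).trace =
      ∑ a, ∑ b, ∑ c, X (a, b) (a, c) * N c b := by
    simp only [trace, diag_apply, mul_apply, Fintype.sum_prod_type, kroneckerMap_apply]
    refine Finset.sum_congr rfl fun a _ => Finset.sum_congr rfl fun b _ => ?_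
    rw [Finset.sum_comm]
    simp [one_apply]
  rw [h1, Finset.sum_comm]
  simp only [trace, diag_apply, mul_apply, traceLeft, of_apply, Finset.sum_mul]
  refine Finset.sum_congr rfl fun b _ => ?_
  rw [Finset.sum_comm]

/-- A measurement on the second factor does not disturb the averaged state of the first one. -/
theorem sum_traceRight_conj {α : Type*} [Fintype α] (B : α → Matrix n n ℂ)
    (hB : ∑ j, ((1 : Matrix m m ℂ) ⊗ₖ B j)ᴴ * ((1 : Matrix m m ℂ) ⊗ₖ B j) = 1)
    (X : Matrix (m × n) (m × n) ℂ) :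
    ∑ j, traceRight ((1 ⊗ₖ B j) * X * (1 ⊗ₖ B j)ᴴ) = traceRight X := by
  refine ext_iff_trace_mul_right.mpr fun N => ?_
  rw [Finset.sum_mul, trace_sum]
  simp only [← trace_mul_kronecker_one]
  have h1 : ∀ j, ((1 ⊗ₖ B j) * X * (1 ⊗ₖ B j)ᴴ * (N ⊗ₖ (1 : Matrix n n ℂ))).trace =
      (X * (N ⊗ₖ (1 : Matrix n n ℂ)) * (((1 : Matrix m m ℂ) ⊗ₖ B j)ᴴ * (1 ⊗ₖ B j))).trace := by
    intro j
    have hc : ((1 : Matrix m m ℂ) ⊗ₖ B j)ᴴ * (N ⊗ₖ (1 : Matrix n n ℂ)) =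
        (N ⊗ₖ (1 : Matrix n n ℂ)) * ((1 : Matrix m m ℂ) ⊗ₖ B j)ᴴ := by
      rw [conjTranspose_kronecker, ← mul_kronecker_mul, ← mul_kronecker_mul]
      simp
    rw [Matrix.mul_assoc, hc, Matrix.mul_assoc, trace_mul_comm]
    simp only [Matrix.mul_assoc]
  rw [Finset.sum_congr rfl fun j _ => h1 j, ← trace_sum, ← Finset.mul_sum, hB, Matrix.mul_one]

/-- A measurement on the first factor does not disturb the averaged state of the second one. -/
theorem sum_traceLeft_conj {α : Type*} [Fintype α] (B : α → Matrix m m ℂ)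
    (hB : ∑ j, (B j ⊗ₖ (1 : Matrix n n ℂ))ᴴ * (B j ⊗ₖ (1 : Matrix n n ℂ)) = 1)
    (X : Matrix (m × n) (m × n) ℂ) :
    ∑ j, traceLeft ((B j ⊗ₖ 1) * X * (B j ⊗ₖ 1)ᴴ) = traceLeft X := by
  refine ext_iff_trace_mul_right.mpr fun N => ?_
  rw [Finset.sum_mul, trace_sum]
  simp only [← trace_mul_one_kronecker]
  have h1 : ∀ j, ((B j ⊗ₖ 1) * X * (B j ⊗ₖ 1)ᴴ * ((1 : Matrix m m ℂ) ⊗ₖ N)).trace =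
      (X * ((1 : Matrix m m ℂ) ⊗ₖ N) * ((B j ⊗ₖ (1 : Matrix n n ℂ))ᴴ * (B j ⊗ₖ 1))).trace := by
    intro j
    have hc : (B j ⊗ₖ (1 : Matrix n n ℂ))ᴴ * ((1 : Matrix m m ℂ) ⊗ₖ N) =
        ((1 : Matrix m m ℂ) ⊗ₖ N) * (B j ⊗ₖ (1 : Matrix n n ℂ))ᴴ := by
      rw [conjTranspose_kronecker, ← mul_kronecker_mul, ← mul_kronecker_mul]
      simp
    rw [Matrix.mul_assoc, hc, Matrix.mul_assoc, trace_mul_comm]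
    simp only [Matrix.mul_assoc]
  rw [Finset.sum_congr rfl fun j _ => h1 j, ← trace_sum, ← Finset.mul_sum, hB, Matrix.mul_one]

/-- The two marginals of a pure state have the same entropy: they are `Ψ Ψᴴ` and `(Ψᴴ Ψ)ᵀ` for
the coefficient matrix `Ψ` of the state vector. -/
theorem entropy_traceRight_eq_entropy_traceLeft {π : Matrix (m × n) (m × n) ℂ}
    (hπ : π ∈ pureStates (m × n)) : entropy (traceRight π) = entropy (traceLeft π) := by
  obtain ⟨ψ, rfl⟩ := exists_eq_vecMulVec_of_mem_pureStates hπ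
  let Ψ : Matrix m n ℂ := Matrix.of fun x z => ψ (x, z)
  have h1 : traceRight (vecMulVec ψ (star ψ)) = Ψ * Ψᴴ := by
    ext x y
    simp [traceRight, vecMulVec_apply, mul_apply, Ψ]
  have h2 : traceLeft (vecMulVec ψ (star ψ)) = (Ψᴴ * Ψ)ᵀ := by
    ext x y
    simp [traceLeft, vecMulVec_apply, mul_apply, Ψ, mul_comm]
  rw [h1, h2, entropy_transpose (isHermitian_conjTranspose_mul_self Ψ),
    entropy_mul_conjTranspose_comm]

theorem sum_re_trace_conj {ι α : Type*} [Fintype ι] [DecidableEq ι] [Fintype α]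
    {A : α → Matrix ι ι ℂ} (hA : ∑ j, (A j)ᴴ * A j = 1) {X : Matrix ι ι ℂ} (hX : X.trace = 1) :
    ∑ j, (A j * X * (A j)ᴴ).trace.re = 1 := by
  have : ∑ j, (A j * X * (A j)ᴴ).trace = 1 := by
    simp only [fun j => trace_mul_comm (A j * X) (A j)ᴴ, ← Matrix.mul_assoc]
    rw [← trace_sum, ← Finset.sum_mul, hA, Matrix.one_mul, hX]
  rw [← Complex.re_sum, this, Complex.one_re]

/-- Concavity of the entropy for an unnormalized decomposition of a state. -/
theorem sum_re_trace_mul_entropy_le {ι α : Type*} [Fintype ι] [DecidableEq ι] [Fintype α]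
    {Y : α → Matrix ι ι ℂ} (hY : ∀ j, (Y j).PosSemidef) (h1 : ∑ j, (Y j).trace.re = 1) :
    ∑ j, (Y j).trace.re * entropy ((Y j).trace.re⁻¹ • Y j) ≤ entropy (∑ j, Y j) := by
  refine (sum_mul_entropy_le (fun j => re_trace_nonneg (hY j)) h1 fun j =>
    (hY j).smul (inv_nonneg.mpr (re_trace_nonneg (hY j)))).trans_eq ?_
  congr 1
  refine Finset.sum_congr rfl fun j _ => ?_
  rcases eq_or_ne (Y j).trace.re 0 with h | h
  · simp [eq_zero_of_re_trace_eq_zero (hY j) h]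
  · rw [smul_smul, mul_inv_cancel₀ h, one_smul]

/-- The entanglement of a pure state does not increase on average when the second party
measures. -/
theorem sum_entropy_traceRight_le_of_right {α : Type*} [Fintype α] (B : α → Matrix n n ℂ)
    (hB : ∑ j, ((1 : Matrix m m ℂ) ⊗ₖ B j)ᴴ * ((1 : Matrix m m ℂ) ⊗ₖ B j) = 1)
    {π : Matrix (m × n) (m × n) ℂ} (hπ : π ∈ pureStates (m × n)) :
    ∑ j, homExt (fun X => entropy (traceRight X)) ((1 ⊗ₖ B j) * π * (1 ⊗ₖ B j)ᴴ) ≤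
      entropy (traceRight π) := by
  have hP := posSemidef_of_mem_pureStates hπ
  have := sum_re_trace_mul_entropy_le
    (Y := fun j => traceRight ((1 ⊗ₖ B j) * π * (1 ⊗ₖ B j)ᴴ))
    (fun j => posSemidef_traceRight (hP.mul_mul_conjTranspose_same _))
    (by simp only [trace_traceRight]; exact sum_re_trace_conj hB hπ.2.2)
  rw [sum_traceRight_conj B hB] at this
  simpa only [homExt, trace_traceRight, traceRight_smul] using this

/-- The entanglement of a pure state does not increase on average when the first party measures:
its entropy may be read off from the marginal of the other party. -/
theorem sum_entropy_traceRight_le_of_left {α : Type*} [Fintype α] (B : α → Matrix m m ℂ)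
    (hB : ∑ j, (B j ⊗ₖ (1 : Matrix n n ℂ))ᴴ * (B j ⊗ₖ (1 : Matrix n n ℂ)) = 1)
    {π : Matrix (m × n) (m × n) ℂ} (hπ : π ∈ pureStates (m × n)) :
    ∑ j, homExt (fun X => entropy (traceRight X)) ((B j ⊗ₖ 1) * π * (B j ⊗ₖ 1)ᴴ) ≤
      entropy (traceRight π) := by
  have hP := posSemidef_of_mem_pureStates hπ
  have := sum_re_trace_mul_entropy_le
    (Y := fun j => traceLeft ((B j ⊗ₖ 1) * π * (B j ⊗ₖ 1)ᴴ))
    (fun j => posSemidef_traceLeft (hP.mul_mul_conjTranspose_same _))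
    (by simp only [trace_traceLeft]; exact sum_re_trace_conj hB hπ.2.2)
  rw [sum_traceLeft_conj B hB] at this
  rw [entropy_traceRight_eq_entropy_traceLeft hπ]
  refine le_of_eq_of_le (Finset.sum_congr rfl fun j _ => ?_) this
  rw [homExt, trace_traceLeft, ← traceLeft_smul]
  rcases eq_or_ne ((B j ⊗ₖ 1) * π * (B j ⊗ₖ (1 : Matrix n n ℂ))ᴴ).trace.re 0 with h | h
  · rw [h, zero_mul, zero_mul]
  · rw [entropy_traceRight_eq_entropy_traceLeft (inv_smul_conj_mem_pureStates hπ _ h)]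

end Bipartite

/-! ### Product operators along a partition -/

section Multipartite

variable {L : Type*} [Fintype L] [DecidableEq L] {d : L → ℕ}

/-- The splitting of the labels of the product basis into those of `K` and of its complement. -/
def splitEquiv (K : Finset L) :
    Config d ≃ SubConfig d K × ((a : {a : L // a ∉ K}) → Fin (d a)) :=
  Equiv.piEquivPiSubtypeProd (fun a => a ∈ K) (fun a => Fin (d a))

theorem reduced_eq_traceRight (K : Finset L) (X : Op d) :
    reduced K X = traceRight (X.submatrix (splitEquiv K).symm (splitEquiv K).symm) := rfl

omit [Fintype L] in
theorem glue_apply_of_mem {K : Finset L} (x : SubConfig d K)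
    (z : (a : {a : L // a ∉ K}) → Fin (d a)) {a : L} (ha : a ∈ K) : glue x z a = x ⟨a, ha⟩ := by
  simp [glue, Equiv.piEquivPiSubtypeProd, ha]

omit [Fintype L] in
theorem glue_apply_of_notMem {K : Finset L} (x : SubConfig d K)
    (z : (a : {a : L // a ∉ K}) → Fin (d a)) {a : L} (ha : a ∉ K) : glue x z a = z ⟨a, ha⟩ := by
  simp [glue, Equiv.piEquivPiSubtypeProd, ha]

theorem posSemidef_reduced (K : Finset L) {X : Op d} (hX : X.PosSemidef) :
    (reduced K X).PosSemidef := by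
  rw [reduced_eq_traceRight]
  exact posSemidef_traceRight (hX.submatrix _)

theorem trace_reduced (K : Finset L) (X : Op d) : (reduced K X).trace = X.trace := by
  rw [reduced_eq_traceRight, trace_traceRight]
  exact (splitEquiv K).symm.sum_comp fun i => X i i

theorem continuous_reduced (K : Finset L) : Continuous (reduced (d := d) K) := by
  unfold reduced
  fun_prop

/-- A basis label of the whole system is a family of basis labels of the parts. -/
theorem bijective_restrict_parts (α : PI L) : Function.Bijective
    fun (x : Config d) (K : α.parts) => (fun a => x a : SubConfig d K) := by
  have hmem : ∀ a : L, α.part a ∈ α.parts := fun a => α.part_mem.mpr (Finset.mem_univ a)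
  constructor
  · intro x y h
    funext a
    exact congrFun (congrFun h ⟨α.part a, hmem a⟩) ⟨a, α.mem_part (Finset.mem_univ a)⟩
  · intro p
    refine ⟨fun a => p ⟨α.part a, hmem a⟩ ⟨a, α.mem_part (Finset.mem_univ a)⟩, ?_⟩
    funext ⟨K, hK⟩ ⟨a, ha⟩
    obtain rfl : α.part a = K := α.part_eq_of_mem hK ha
    rfl

/-- Sums over the product basis factorize along a partition. -/
theorem sum_prod_parts (α : PI L) (g : (K : Finset L) → SubConfig d K → ℂ) :
    ∑ x : Config d, ∏ K ∈ α.parts, g K (fun a => x a) = ∏ K ∈ α.parts, ∑ v, g K v := by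
  rw [← Finset.prod_coe_sort α.parts fun K => ∑ v, g K v, Finset.prod_univ_sum,
    Fintype.piFinset_univ]
  refine Fintype.sum_bijective _ (bijective_restrict_parts α) _ _ fun x => ?_
  exact (Finset.prod_coe_sort α.parts fun K => g K (fun a => x a)).symm

variable {φ φ' : (K : Finset L) → Matrix (SubConfig d K) (SubConfig d K) ℂ}

theorem tensorParts_congr {α : PI L} (h : ∀ K ∈ α.parts, φ K = φ' K) :
    tensorParts α φ = tensorParts α φ' := by
  ext x y
  exact Finset.prod_congr rfl fun K hK => by rw [h K hK]

theorem tensorParts_mul (α : PI L) :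
    tensorParts α φ * tensorParts α φ' = tensorParts α fun K => φ K * φ' K := by
  ext x y
  simp only [mul_apply, tensorParts, of_apply, ← Finset.prod_mul_distrib]
  exact sum_prod_parts α fun K v => φ K (fun a => x a) v * φ' K v (fun a => y a)

theorem tensorParts_one (α : PI L) : tensorParts (d := d) α (fun _ => 1) = 1 := by
  ext x y
  rw [tensorParts, of_apply]
  by_cases h : x = y
  · subst h
    simp
  · rw [one_apply_ne h]
    obtain ⟨a, ha⟩ := Function.ne_iff.mp h
    refine Finset.prod_eq_zero (α.part_mem.mpr (Finset.mem_univ a)) (one_apply_ne fun h' => ha ?_)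
    exact congrFun h' ⟨a, α.mem_part (Finset.mem_univ a)⟩

theorem tensorParts_conjTranspose (α : PI L) :
    (tensorParts α φ)ᴴ = tensorParts α fun K => (φ K)ᴴ := by
  ext x y
  simp [tensorParts, conjTranspose_apply]

theorem trace_tensorParts (α : PI L) :
    (tensorParts α φ).trace = ∏ K ∈ α.parts, (φ K).trace :=
  sum_prod_parts α fun K v => φ K v v

theorem tensorParts_mem_pureStates {α : PI L}
    (h : ∀ K ∈ α.parts, φ K ∈ pureStates (SubConfig d K)) :
    tensorParts α φ ∈ pureStates (Config d) := by
  refine ⟨?_, ?_, ?_⟩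
  · rw [IsHermitian, tensorParts_conjTranspose]
    exact tensorParts_congr fun K hK => (h K hK).1
  · rw [tensorParts_mul]
    exact tensorParts_congr fun K hK => (h K hK).2.1
  · rw [trace_tensorParts]
    exact Finset.prod_eq_one fun K hK => (h K hK).2.2

theorem sepPure_subset_pureStates (α : PI L) : sepPure d α ⊆ pureStates (Config d) := by
  rintro _ ⟨φ, hφ, rfl⟩
  exact tensorParts_mem_pureStates hφ

/-- Parts other than `K` lie in the complement of `K`, so that they do not see the labels of
`K`. -/
theorem glue_restrict_congr {α : PI L} {K K' : Finset L} (hK : K ∈ α.parts)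
    (hK' : K' ∈ α.parts) (hne : K' ≠ K) (x y : SubConfig d K)
    (z : (a : {a : L // a ∉ K}) → Fin (d a)) :
    (fun a => glue x z a : SubConfig d K') = fun a : K' => glue y z a := by
  funext ⟨a, ha⟩
  have hak : a ∉ K := fun h => hne (α.eq_of_mem_parts hK' hK ha h)
  simp only [glue_apply_of_notMem _ _ hak]

omit [Fintype L] in
theorem glue_restrict_self {K : Finset L} (x : SubConfig d K)
    (z : (a : {a : L // a ∉ K}) → Fin (d a)) : (fun a => glue x z a : SubConfig d K) = x := by
  funext ⟨a, ha⟩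
  exact glue_apply_of_mem x z ha

/-- The reduced states of a product state are its factors. -/
theorem reduced_tensorParts {α : PI L} {K : Finset L} (hK : K ∈ α.parts)
    (h : ∀ K' ∈ α.parts, (φ K').trace = 1) : reduced K (tensorParts α φ) = φ K := by
  ext x y
  -- The weight that pins the label of `K` to `x` and takes the diagonal of the other factors.
  let g : (K' : Finset L) → SubConfig d K' → ℂ :=
    Function.update (fun K' v => φ K' v v) K (fun v => if v = x then 1 else 0)
  have hg : ∏ K' ∈ α.parts, ∑ v, g K' v = 1 := by
    refine Finset.prod_eq_one fun K' hK' => ?_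
    by_cases hne : K' = K
    · subst hne
      simp [g]
    · simp only [g, Function.update_of_ne hne]
      exact h K' hK'
  rw [← sum_prod_parts, ← (splitEquiv K).symm.sum_comp, Fintype.sum_prod_type,
    Finset.sum_eq_single x] at hg
  · calc reduced K (tensorParts α φ) x y
        = ∑ z, φ K x y * ∏ K' ∈ α.parts, g K' (fun a => glue x z a) := by
          refine Finset.sum_congr rfl fun z _ => ?_
          rw [tensorParts, of_apply, ← Finset.mul_prod_erase _ _ hK,
            ← Finset.mul_prod_erase _ (fun K' => g K' _) hK, glue_restrict_self,
            glue_restrict_self]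
          simp only [g, Function.update_self, if_true, one_mul]
          congr 1
          refine Finset.prod_congr rfl fun K' hK' => ?_
          obtain ⟨hne, hK'⟩ := Finset.mem_erase.mp hK'
          rw [Function.update_of_ne hne, glue_restrict_congr hK hK' hne x y z]
      _ = φ K x y := by
          rw [← Finset.mul_sum]
          exact (congrArg _ hg).trans (mul_one _)
  · intro v _ hv
    refine Finset.sum_eq_zero fun z _ => Finset.prod_eq_zero hK ?_
    have : (fun a => (splitEquiv K).symm (v, z) a : SubConfig d K) = v := glue_restrict_self v z
    rw [this]
    simp [g, hv]
  · simp

/-- The operator acting as `M` on the part `K` and as the identity elsewhere, in the splitting of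
the system into `K` and its complement. -/
theorem tensorParts_update_submatrix {α : PI L} {K : Finset L} (hK : K ∈ α.parts)
    (M : Matrix (SubConfig d K) (SubConfig d K) ℂ) :
    (tensorParts α (Function.update (fun _ => 1) K M)).submatrix
      (splitEquiv K).symm (splitEquiv K).symm = M ⊗ₖ 1 := by
  ext ⟨x, z⟩ ⟨y, w⟩
  change tensorParts α _ (glue x z) (glue y w) = M x y * (1 : Matrix _ _ ℂ) z w
  rw [tensorParts, of_apply, ← Finset.mul_prod_erase _ _ hK, glue_restrict_self,
    glue_restrict_self, Function.update_self]
  congr 1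
  by_cases hzw : z = w
  · subst hzw
    rw [one_apply_eq]
    refine Finset.prod_eq_one fun K' hK' => ?_
    obtain ⟨hne, hK'⟩ := Finset.mem_erase.mp hK'
    rw [Function.update_of_ne hne, glue_restrict_congr hK hK' hne x y z, one_apply_eq]
  · rw [one_apply_ne hzw]
    obtain ⟨⟨a, ha⟩, haz⟩ := Function.ne_iff.mp hzw
    have hne : α.part a ≠ K := fun h => ha (h ▸ α.mem_part (Finset.mem_univ a))
    refine Finset.prod_eq_zero (i := α.part a)
      (Finset.mem_erase.mpr ⟨hne, α.part_mem.mpr (Finset.mem_univ a)⟩) ?_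
    rw [Function.update_of_ne hne]
    refine one_apply_ne fun h' => haz ?_
    have := congrFun h' ⟨a, α.mem_part (Finset.mem_univ a)⟩
    simpa only [glue_apply_of_notMem _ _ ha] using this

theorem trace_tensorParts_update_mul {α : PI L} {K : Finset L} (hK : K ∈ α.parts)
    (M : Matrix (SubConfig d K) (SubConfig d K) ℂ) (X : Op d) :
    (tensorParts α (Function.update (fun _ => 1) K M) * X).trace = (M * reduced K X).trace := by
  rw [trace_mul_comm, trace_mul_comm M, reduced_eq_traceRight, ← trace_mul_kronecker_one,
    ← tensorParts_update_submatrix hK, submatrix_mul_equiv]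
  exact ((splitEquiv K).symm.sum_comp fun i => (X * _) i i).symm

/-- A pure state all of whose reduced states along `α` are pure is their product: it is fixed by
the projectors onto the reduced states, hence by their product, which is of rank one. -/
theorem eq_tensorParts_of_reduced_mem_pureStates {α : PI L} {π : Op d}
    (hπ : π ∈ pureStates (Config d))
    (h : ∀ K ∈ α.parts, reduced K π ∈ pureStates (SubConfig d K)) :
    π = tensorParts α fun K => reduced K π := by
  have hone : ∀ K ∈ α.parts,
      tensorParts α (Function.update (fun _ => 1) K (reduced K π)) * π = π := by
    intro K hK
    refine mul_eq_self_of_trace_eq_one ?_ ?_ hπ ?_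
    · rw [IsHermitian, tensorParts_conjTranspose]
      refine tensorParts_congr fun K' _ => ?_
      rcases eq_or_ne K' K with rfl | hne
      · simpa using (h K' hK).1.eq
      · simp [Function.update_of_ne hne]
    · rw [tensorParts_mul]
      refine tensorParts_congr fun K' _ => ?_
      rcases eq_or_ne K' K with rfl | hne
      · simpa using (h K' hK).2.1
      · simp [Function.update_of_ne hne]
    · rw [trace_tensorParts_update_mul hK, (h K hK).2.1, (h K hK).2.2]
  have hall : ∀ s ⊆ α.parts,
      tensorParts α (fun K => if K ∈ s then reduced K π else 1) * π = π := by
    intro s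
    induction s using Finset.induction_on with
    | empty => intro _; simp [tensorParts_one]
    | insert K s hKs ih =>
      intro hs
      have h1 : tensorParts α (fun K' => if K' ∈ insert K s then reduced K' π else 1) =
          tensorParts α (Function.update (fun _ => 1) K (reduced K π)) *
            tensorParts α (fun K' => if K' ∈ s then reduced K' π else 1) := by
        rw [tensorParts_mul]
        refine tensorParts_congr fun K' _ => ?_
        rcases eq_or_ne K' K with rfl | hne
        · simp [hKs]
        · simp [hne]
      rw [h1, Matrix.mul_assoc, ih fun K' hK' => hs (Finset.mem_insert_of_mem hK')]
      exact hone K (hs (Finset.mem_insert_self K s))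
  have hfix : tensorParts α (fun K => reduced K π) * π = π := by
    have h1 := hall α.parts subset_rfl
    rwa [tensorParts_congr (φ' := fun K => reduced K π) fun K hK => if_pos hK] at h1
  exact (eq_of_trace_mul_eq_one (tensorParts_mem_pureStates h) hπ (by rw [hfix, hπ.2.2])).symm

/-! ### Entanglement entropies of pure states -/

theorem reduced_isState (K : Finset L) {π : Op d} (hπ : π ∈ pureStates (Config d)) :
    (reduced K π).PosSemidef ∧ (reduced K π).trace = 1 :=
  ⟨posSemidef_reduced K (posSemidef_of_mem_pureStates hπ), by rw [trace_reduced, hπ.2.2]⟩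

theorem entropy_reduced_nonneg (K : Finset L) {π : Op d} (hπ : π ∈ pureStates (Config d)) :
    0 ≤ entropy (reduced K π) :=
  entropy_nonneg (reduced_isState K hπ).1 (reduced_isState K hπ).2

theorem entI_nonneg (α : PI L) {π : Op d} (hπ : π ∈ pureStates (Config d)) : 0 ≤ entI α π :=
  mul_nonneg (by norm_num) (Finset.sum_nonneg fun K _ => entropy_reduced_nonneg K hπ)

theorem sum_log_card_parts (α : PI L) (hd : ∀ a, 0 < d a) :
    ∑ K ∈ α.parts, Real.log (Fintype.card (SubConfig d K)) = ∑ a, Real.log (d a) := by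
  have h1 : ∀ K : Finset L, Real.log (Fintype.card (SubConfig d K)) = ∑ a ∈ K, Real.log (d a) := by
    intro K
    rw [Fintype.card_pi, Nat.cast_prod, Real.log_prod fun a _ => by
      simpa using (hd a).ne', ← Finset.sum_coe_sort K]
    simp
  rw [Finset.sum_congr rfl fun K _ => h1 K]
  conv_rhs => rw [← α.biUnion_parts]
  exact (Finset.sum_biUnion α.disjoint).symm

theorem entI_le (α : PI L) (hd : ∀ a, 0 < d a) {π : Op d} (hπ : π ∈ pureStates (Config d)) :
    entI α π ≤ (1 / 2) * ∑ a, Real.log (d a) := by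
  rw [← sum_log_card_parts α hd]
  exact mul_le_mul_of_nonneg_left (Finset.sum_le_sum fun K _ => entropy_le_log_card
    (reduced_isState K hπ).1 (reduced_isState K hπ).2) (by norm_num)

/-- The `α`-entanglement entropy detects the `α`-separable pure states. -/
theorem entI_eq_zero_iff {α : PI L} {π : Op d} (hπ : π ∈ pureStates (Config d)) :
    entI α π = 0 ↔ π ∈ sepPure d α := by
  have h1 : entI α π = 0 ↔ ∀ K ∈ α.parts, reduced K π ∈ pureStates (SubConfig d K) := by
    rw [entI, mul_eq_zero_iff_left (by norm_num), Finset.sum_eq_zero_iff_of_nonneg fun K _ =>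
      entropy_reduced_nonneg K hπ]
    exact forall₂_congr fun K _ =>
      entropy_eq_zero_iff (reduced_isState K hπ).1 (reduced_isState K hπ).2
  rw [h1]
  constructor
  · intro h
    exact ⟨fun K => reduced K π, h, eq_tensorParts_of_reduced_mem_pureStates hπ h⟩
  · rintro ⟨φ, hφ, rfl⟩ K hK
    rw [reduced_tensorParts hK fun K' hK' => (hφ K' hK').2.2]
    exact hφ K hK

theorem continuousOn_entI (α : PI L) : ContinuousOn (entI (d := d) α) (pureStates (Config d)) := by
  refine continuousOn_const.mul (continuousOn_finsetSum _ fun K _ => ?_)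
  exact continuousOn_entropy.comp (continuous_reduced K).continuousOn
    fun π hπ => reduced_isState K hπ

theorem exists_entII_eq (A : PII L) (π : Op d) : ∃ α ∈ A.1, entII A π = entI α π := by
  have hfin : ((fun α => entI α π) '' (A.1 : Set (PI L))).Finite := Set.toFinite _
  obtain ⟨α, hα, h⟩ := (A.2.image fun α => entI α π).csInf_mem hfin
  exact ⟨α, hα, h.symm⟩

theorem entII_le_entI {A : PII L} {α : PI L} (hα : α ∈ A.1) (π : Op d) :
    entII A π ≤ entI α π :=
  csInf_le (Set.toFinite _).bddBelow ⟨α, hα, rfl⟩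

theorem entII_nonneg (A : PII L) {π : Op d} (hπ : π ∈ pureStates (Config d)) :
    0 ≤ entII A π := by
  obtain ⟨α, -, h⟩ := exists_entII_eq A π
  exact h ▸ entI_nonneg α hπ

theorem entII_eq_zero_iff {A : PII L} {π : Op d} (hπ : π ∈ pureStates (Config d)) :
    entII A π = 0 ↔ π ∈ sepPureII d A := by
  simp only [sepPureII, Set.mem_iUnion, exists_prop]
  constructor
  · intro h
    obtain ⟨α, hα, h'⟩ := exists_entII_eq A π
    exact ⟨α, hα, (entI_eq_zero_iff hπ).mp (h' ▸ h)⟩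
  · rintro ⟨α, hα, h⟩
    exact le_antisymm ((entII_le_entI hα π).trans_eq ((entI_eq_zero_iff hπ).mpr h))
      (entII_nonneg A hπ)

theorem continuousOn_entII (A : PII L) :
    ContinuousOn (entII (d := d) A) (pureStates (Config d)) := by
  have hne : (Set.toFinite (A.1 : Set (PI L))).toFinset.Nonempty := by simpa using A.2
  have h : entII (d := d) A = fun π =>
      (Set.toFinite (A.1 : Set (PI L))).toFinset.inf' hne fun α => entI α π := by
    funext π
    rw [Finset.inf'_eq_csInf_image]
    simp [entII]
  rw [h]
  exact ContinuousOn.finset_inf'_apply hne fun α _ => continuousOn_entI α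

end Multipartite

/-! ### Monotonicity under LOCC -/

section LOCC

variable {L : Type*} [Fintype L] [DecidableEq L] {d : L → ℕ}

theorem localOp_eq_submatrix (a : L) (M : Matrix (Fin (d a)) (Fin (d a)) ℂ) :
    localOp a M = (M ⊗ₖ (1 : Matrix _ _ ℂ)).submatrix (Equiv.piSplitAt a fun b => Fin (d b))
      (Equiv.piSplitAt a fun b => Fin (d b)) := by
  ext x y
  have h : (∀ b, b ≠ a → x b = y b) ↔
      (fun b : {b // b ≠ a} => x b) = fun b : {b // b ≠ a} => y b :=
    ⟨fun h => funext fun b => h b b.2, fun h b hb => congrFun h ⟨b, hb⟩⟩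
  simp only [localOp, of_apply, submatrix_apply, kroneckerMap_apply, Equiv.piSplitAt_apply,
    one_apply, h, mul_ite, mul_one, mul_zero]

theorem sum_localOp_conjTranspose_mul {α : Type*} [Fintype α] (a : L)
    {M : α → Matrix (Fin (d a)) (Fin (d a)) ℂ} (hM : ∑ j, (M j)ᴴ * M j = 1) :
    ∑ j, (localOp a (M j))ᴴ * localOp a (M j) = 1 := by
  have h1 : ∀ j, (localOp a (M j))ᴴ * localOp a (M j) =
      (((M j)ᴴ * M j) ⊗ₖ (1 : Matrix _ _ ℂ)).submatrix (Equiv.piSplitAt a fun b => Fin (d b))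
        (Equiv.piSplitAt a fun b => Fin (d b)) := by
    intro j
    rw [localOp_eq_submatrix, conjTranspose_submatrix, submatrix_mul_equiv,
      conjTranspose_kronecker, ← mul_kronecker_mul]
    simp
  rw [Finset.sum_congr rfl fun j _ => h1 j]
  ext x y
  rw [Matrix.sum_apply]
  simp only [submatrix_apply, kroneckerMap_apply, ← Finset.sum_mul]
  rw [← Matrix.sum_apply, hM]
  change ((1 : Matrix _ _ ℂ) ⊗ₖ (1 : Matrix _ _ ℂ)) _ _ = _
  rw [one_kronecker_one, one_apply, one_apply]
  simp only [EmbeddingLike.apply_eq_iff_eq]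

/-- A local operator of a party outside of `K` acts on the complement of `K` only. -/
theorem localOp_submatrix_of_notMem {K : Finset L} {a : L} (ha : a ∉ K)
    (M : Matrix (Fin (d a)) (Fin (d a)) ℂ) :
    (localOp a M).submatrix (splitEquiv K).symm (splitEquiv K).symm =
      1 ⊗ₖ (Matrix.of fun z w => if ∀ b : {b // b ∉ K}, b.1 ≠ a → z b = w b then
        M (z ⟨a, ha⟩) (w ⟨a, ha⟩) else 0) := by
  ext ⟨x, z⟩ ⟨y, w⟩
  change localOp a M (glue x z) (glue y w) = (1 : Matrix _ _ ℂ) x y * _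
  have h : (∀ b, b ≠ a → glue x z b = glue y w b) ↔
      x = y ∧ ∀ b : {b // b ∉ K}, b.1 ≠ a → z b = w b := by
    constructor
    · refine fun h => ⟨funext fun ⟨b, hb⟩ => ?_, fun ⟨b, hb⟩ hba => ?_⟩
      · simpa only [glue_apply_of_mem _ _ hb] using h b fun hba => ha (hba ▸ hb)
      · simpa only [glue_apply_of_notMem _ _ hb] using h b hba
    · rintro ⟨rfl, h⟩ b hba
      by_cases hb : b ∈ K
      · simp only [glue_apply_of_mem _ _ hb]
      · simpa only [glue_apply_of_notMem _ _ hb] using h ⟨b, hb⟩ hba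
  rw [localOp, of_apply, of_apply, glue_apply_of_notMem _ _ ha, glue_apply_of_notMem _ _ ha]
  simp only [h, one_apply, ite_and, ite_mul, one_mul, zero_mul]

/-- A local operator of a party in `K` acts on `K` only. -/
theorem localOp_submatrix_of_mem {K : Finset L} {a : L} (ha : a ∈ K)
    (M : Matrix (Fin (d a)) (Fin (d a)) ℂ) :
    (localOp a M).submatrix (splitEquiv K).symm (splitEquiv K).symm =
      (Matrix.of fun x y => if ∀ b : K, b.1 ≠ a → x b = y b then
        M (x ⟨a, ha⟩) (y ⟨a, ha⟩) else 0) ⊗ₖ 1 := by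
  ext ⟨x, z⟩ ⟨y, w⟩
  change localOp a M (glue x z) (glue y w) = _ * (1 : Matrix _ _ ℂ) z w
  have h : (∀ b, b ≠ a → glue x z b = glue y w b) ↔
      z = w ∧ ∀ b : K, b.1 ≠ a → x b = y b := by
    constructor
    · refine fun h => ⟨funext fun ⟨b, hb⟩ => ?_, fun ⟨b, hb⟩ hba => ?_⟩
      · simpa only [glue_apply_of_notMem _ _ hb] using h b fun hba => hb (hba ▸ ha)
      · simpa only [glue_apply_of_mem _ _ hb] using h b hba
    · rintro ⟨rfl, h⟩ b hba
      by_cases hb : b ∈ K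
      · simpa only [glue_apply_of_mem _ _ hb] using h ⟨b, hb⟩ hba
      · simp only [glue_apply_of_notMem _ _ hb]
  rw [localOp, of_apply, of_apply, glue_apply_of_mem _ _ ha, glue_apply_of_mem _ _ ha]
  simp only [h, one_apply, ite_and, mul_ite, mul_one, mul_zero]

theorem conj_submatrix_equiv {ι κ : Type*} [Fintype ι] [Fintype κ] (e : κ ≃ ι)
    (A X : Matrix ι ι ℂ) :
    (A * X * Aᴴ).submatrix e e = A.submatrix e e * X.submatrix e e * (A.submatrix e e)ᴴ := by
  rw [conjTranspose_submatrix, submatrix_mul_equiv, submatrix_mul_equiv]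

theorem trace_submatrix_equiv {ι κ : Type*} [Fintype ι] [Fintype κ] (e : κ ≃ ι)
    (X : Matrix ι ι ℂ) : (X.submatrix e e).trace = X.trace :=
  e.sum_comp fun i => X i i

/-- The entropy of a reduced state of a pure state does not increase on average under a
measurement of one party, be it inside or outside of the subsystem. -/
theorem sum_homExt_entropy_reduced_le (K : Finset L) (a : L) {k : ℕ}
    {M : Fin k → Matrix (Fin (d a)) (Fin (d a)) ℂ} (hM : ∑ j, (M j)ᴴ * M j = 1)
    {π : Op d} (hπ : π ∈ pureStates (Config d)) :
    ∑ j, homExt (fun X => entropy (reduced K X)) (localOp a (M j) * π * (localOp a (M j))ᴴ) ≤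
      entropy (reduced K π) := by
  have hA := sum_localOp_conjTranspose_mul a hM
  set e := (splitEquiv (d := d) K).symm with he
  have hA' : ∑ j, ((localOp a (M j)).submatrix e e)ᴴ * (localOp a (M j)).submatrix e e = 1 := by
    have := congrArg (fun X : Op d => X.submatrix e e) hA
    simp only [submatrix_one_equiv] at this
    rw [← this]
    ext x y
    simp only [Matrix.sum_apply, submatrix_apply, conjTranspose_submatrix, submatrix_mul_equiv]
  have hπ' := submatrix_equiv_mem_pureStates e hπ
  have hext : ∀ X : Op d, homExt (fun X => entropy (reduced K X)) X =
      homExt (fun X => entropy (traceRight X)) (X.submatrix e e) := by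
    intro X
    rw [homExt, homExt, trace_submatrix_equiv]
    rfl
  simp only [hext, conj_submatrix_equiv, reduced_eq_traceRight K π]
  by_cases ha : a ∈ K
  · simp only [he, localOp_submatrix_of_mem ha] at hA' ⊢
    exact sum_entropy_traceRight_le_of_left _ hA' hπ'
  · simp only [he, localOp_submatrix_of_notMem ha] at hA' ⊢
    exact sum_entropy_traceRight_le_of_right _ hA' hπ'

theorem sum_homExt_entI_le (α : PI L) (a : L) {k : ℕ}
    {M : Fin k → Matrix (Fin (d a)) (Fin (d a)) ℂ} (hM : ∑ j, (M j)ᴴ * M j = 1)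
    {π : Op d} (hπ : π ∈ pureStates (Config d)) :
    ∑ j, homExt (entI α) (localOp a (M j) * π * (localOp a (M j))ᴴ) ≤ entI α π := by
  have h : ∀ X : Op d, homExt (entI α) X =
      (1 / 2) * ∑ K ∈ α.parts, homExt (fun X => entropy (reduced K X)) X := by
    intro X
    simp only [homExt, entI, ← Finset.mul_sum]
    ring
  simp only [h, ← Finset.mul_sum]
  rw [Finset.sum_comm]
  exact mul_le_mul_of_nonneg_left
    (Finset.sum_le_sum fun K _ => sum_homExt_entropy_reduced_le K a hM hπ) (by norm_num)

/-- On pure states a measurement of one party does not increase the `A`-entanglement on average: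
the partition that is optimal for `π` is admissible for all outcomes. -/
theorem sum_homExt_entOF_le_entII (A : PII L) (a : L) {k : ℕ}
    {M : Fin k → Matrix (Fin (d a)) (Fin (d a)) ℂ} (hM : ∑ j, (M j)ᴴ * M j = 1)
    {π : Op d} (hπ : π ∈ pureStates (Config d)) :
    ∑ j, homExt (entOF A) (localOp a (M j) * π * (localOp a (M j))ᴴ) ≤ entII A π := by
  obtain ⟨α, hα, hmin⟩ := exists_entII_eq A π
  rw [hmin]
  refine (Finset.sum_le_sum fun j _ => ?_).trans (sum_homExt_entI_le α a hM hπ)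
  have hY := (posSemidef_of_mem_pureStates hπ).mul_mul_conjTranspose_same (localOp a (M j))
  rcases eq_or_ne (localOp a (M j) * π * (localOp a (M j))ᴴ).trace.re 0 with h | h
  · simp [homExt, h]
  · exact mul_le_mul_of_nonneg_left ((convexRoof_le_of_mem_pureStates (continuousOn_entII A)
      (inv_smul_conj_mem_pureStates hπ _ h)).trans (entII_le_entI hα _)) (re_trace_nonneg hY)

/-- The map `X ↦ A X Aᴴ`. -/
def conjMap {ι : Type*} [Fintype ι] (A : Matrix ι ι ℂ) : Matrix ι ι ℂ →ₗ[ℝ] Matrix ι ι ℂ where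
  toFun X := A * X * Aᴴ
  map_add' X Y := by rw [Matrix.mul_add, Matrix.add_mul]
  map_smul' c X := by simp

/-- The induction over the rounds of a protocol: merging runs is covered by the subadditivity of
the homogeneous extension, and a single round by the case of pure states. -/
theorem FiniteLOCC.posSemidef_and_sum_homExt_le (A : PII L) {m : ℕ} {Λ : Fin m → Op d → Op d}
    (hΛ : FiniteLOCC Λ) {X : Op d} (hX : X.PosSemidef) :
    (∀ i, (Λ i X).PosSemidef) ∧ ∑ i, homExt (entOF A) (Λ i X) ≤ homExt (entOF A) X := by
  induction hΛ generalizing X with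
  | halt i₀ =>
    constructor
    · intro i
      by_cases h : i = i₀
      · simpa [h] using hX
      · simpa [h] using PosSemidef.zero
    · rw [Finset.sum_eq_single i₀]
      · simp
      · intro i _ hi
        simp [hi]
      · simp
  | measure a k M hM Λ hΛ ih =>
    have hY : ∀ j, (localOp a (M j) * X * (localOp a (M j))ᴴ).PosSemidef :=
      fun j => hX.mul_mul_conjTranspose_same _
    refine ⟨fun i => posSemidef_sum _ fun j _ => (ih j (hY j)).1 i, ?_⟩
    calc ∑ i, homExt (entOF A) (∑ j, Λ j i (localOp a (M j) * X * (localOp a (M j))ᴴ))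
        ≤ ∑ i, ∑ j, homExt (entOF A) (Λ j i (localOp a (M j) * X * (localOp a (M j))ᴴ)) :=
          Finset.sum_le_sum fun i _ => homExt_sum_le
            (convexOn_convexRoof (continuousOn_entII A)) _ fun j => (ih j (hY j)).1 i
      _ = ∑ j, ∑ i, homExt (entOF A) (Λ j i (localOp a (M j) * X * (localOp a (M j))ᴴ)) :=
          Finset.sum_comm
      _ ≤ ∑ j, homExt (entOF A) (localOp a (M j) * X * (localOp a (M j))ᴴ) :=
          Finset.sum_le_sum fun j _ => (ih j (hY j)).2
      _ ≤ homExt (entOF A) X :=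
          sum_homExt_convexRoof_le (continuousOn_entII A) (fun j => conjMap (localOp a (M j)))
            (fun j X hX => hX.mul_mul_conjTranspose_same _)
            (fun π hπ => sum_homExt_entOF_le_entII A a hM hπ) hX

theorem isClosed_posSemidef {ι : Type*} [Fintype ι] :
    IsClosed {X : Matrix ι ι ℂ | X.PosSemidef} := by
  simp only [posSemidef_iff_dotProduct_mulVec, Set.ofPred_and, Set.ofPred_forall]
  refine IsClosed.inter (isClosed_eq (by fun_prop) continuous_id) (isClosed_iInter fun x => ?_)
  exact isClosed_le continuous_const
    (continuous_const.dotProduct (continuous_id.matrix_mulVec continuous_const))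

end LOCC

/-! ### The entanglement of formation -/

section EntOF

variable {L : Type*} [Fintype L] [DecidableEq L] {d : L → ℕ}

theorem entOF_nonneg (A : PII L) {ρ : Op d} (hρ : ρ ∈ mixedStates (Config d)) :
    0 ≤ entOF A ρ := by
  obtain ⟨m, p, π, hp, -, hπ, -, ht⟩ := (isLeast_convexRoof (continuousOn_entII A) hρ).1
  rw [entOF, ht]
  exact Finset.sum_nonneg fun i _ => mul_nonneg (hp i) (entII_nonneg A (hπ i))

theorem entOF_le (A : PII L) (hd : ∀ a, 0 < d a) {ρ : Op d} (hρ : ρ ∈ mixedStates (Config d)) :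
    entOF A ρ ≤ (1 / 2) * ∑ a, Real.log (d a) := by
  obtain ⟨m, p, π, hp, hp1, hπ, -, ht⟩ := (isLeast_convexRoof (continuousOn_entII A) hρ).1
  obtain ⟨α, hα⟩ := A.2
  rw [entOF, ht]
  calc ∑ i, p i * entII A (π i)
      ≤ ∑ i, p i * ((1 / 2) * ∑ a, Real.log (d a)) :=
        Finset.sum_le_sum fun i _ => mul_le_mul_of_nonneg_left
          ((entII_le_entI hα _).trans (entI_le α hd (hπ i))) (hp i)
    _ = _ := by rw [← Finset.sum_mul, hp1, one_mul]

/-- The entanglement of formation detects the separable mixed states: a decomposition of average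
zero consists of separable pure states. -/
theorem mem_sepMixedII_iff (A : PII L) {ρ : Op d} (hρ : ρ ∈ mixedStates (Config d)) :
    ρ ∈ sepMixedII d A ↔ entOF A ρ = 0 := by
  have hsub : sepPureII d A ⊆ pureStates (Config d) :=
    Set.iUnion₂_subset fun α _ => sepPure_subset_pureStates α
  constructor
  · intro h
    refine le_antisymm (convexRoof_le (continuousOn_entII A) hρ ?_) (entOF_nonneg A hρ)
    obtain ⟨κ, _, w, z, hw, hw1, hz, hx⟩ := mem_convexHull_iff_exists_fintype.mp h
    refine mem_convexHull_of_exists_fintype w (fun i => (z i, entII A (z i))) hw hw1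
      (fun i => ⟨z i, hsub (hz i), rfl⟩) ?_
    have h0 : ∀ i, entII A (z i) = 0 := fun i => (entII_eq_zero_iff (hsub (hz i))).mpr (hz i)
    rw [← hx]
    ext1 <;> simp [Prod.fst_sum, Prod.snd_sum, h0]
  · intro h
    obtain ⟨m, p, π, hp, hp1, hπ, hρπ, ht⟩ := (isLeast_convexRoof (continuousOn_entII A) hρ).1
    rw [← entOF, h, eq_comm, Finset.sum_eq_zero_iff_of_nonneg fun i _ =>
      mul_nonneg (hp i) (entII_nonneg A (hπ i))] at ht
    rw [← hρπ, ← Finset.sum_filter_of_ne (p := fun i => p i ≠ 0) fun i _ hi =>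
      left_ne_zero_of_smul hi]
    refine (convex_convexHull ℝ _).sum_mem (fun i _ => hp i) (by rwa [Finset.sum_filter_ne_zero])
      fun i hi => subset_convexHull ℝ _ ?_
    exact (entII_eq_zero_iff (hπ i)).mp
      ((mul_eq_zero.mp (ht i (Finset.mem_univ i))).resolve_left (Finset.mem_filter.mp hi).2)

/-- Limits of protocols are covered by the lower semicontinuity of the convex roof. -/
theorem isEntanglementMonotone_entOF (A : PII L) :
    IsEntanglementMonotone (d := d) (entOF A) := by
  refine ⟨convexOn_convexRoof (continuousOn_entII A), fun m Λ hΛ ρ hρ => ?_⟩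
  change ∑ i, homExt (entOF A) (Λ i ρ) ≤ entOF A ρ
  obtain ⟨Λs, hfin, hlim⟩ := hΛ
  obtain ⟨hP, ht⟩ := mem_mixedStates_iff.mp hρ
  have hPs : ∀ N i, (Λs N i ρ).PosSemidef := fun N i =>
    ((hfin N).posSemidef_and_sum_homExt_le A hP).1 i
  have hPl : ∀ i, (Λ i ρ).PosSemidef := fun i =>
    isClosed_posSemidef.mem_of_tendsto (hlim i ρ) (Eventually.of_forall fun N => hPs N i)
  have hle : ∀ N, ∑ i, homExt (entOF A) (Λs N i ρ) ≤ entOF A ρ := fun N =>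
    ((hfin N).posSemidef_and_sum_homExt_le A hP).2.trans_eq (homExt_of_trace_eq_one ht)
  have hlsc := lowerSemicontinuousOn_homExt
    (lowerSemicontinuousOn_convexRoof (continuousOn_entII (d := d) A))
    fun σ hσ => entOF_nonneg A hσ
  refine le_of_forall_pos_le_add fun ε hε => ?_
  have hδ : 0 < ε / (m + 1) := by positivity
  have hev : ∀ i, ∀ᶠ N in atTop,
      homExt (entOF A) (Λ i ρ) - ε / (m + 1) < homExt (entOF A) (Λs N i ρ) := fun i =>
    (tendsto_nhdsWithin_iff.mpr ⟨hlim i ρ, Eventually.of_forall fun N => hPs N i⟩).eventually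
      (hlsc _ (hPl i) _ (sub_lt_self _ hδ))
  obtain ⟨N, hN⟩ := (eventually_all.mpr hev).exists
  have h1 : ∑ i, (homExt (entOF A) (Λ i ρ) - ε / (m + 1)) ≤ entOF A ρ :=
    (Finset.sum_le_sum fun i _ => (hN i).le).trans (hle N)
  have h2 : (m : ℝ) * (ε / (m + 1)) ≤ ε := by
    rw [mul_div_assoc', div_le_iff₀ (by positivity)]
    nlinarith
  simp only [Finset.sum_sub_distrib, Finset.sum_const, Finset.card_univ, Fintype.card_fin,
    nsmul_eq_mul] at h1
  linarith

theorem entOF_anti {A B : PII L} (h : B ≤ A) {ρ : Op d} (hρ : ρ ∈ mixedStates (Config d)) :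
    entOF A ρ ≤ entOF B ρ := by
  obtain ⟨m, p, π, hp, hp1, hπ, hρπ, ht⟩ := (isLeast_convexRoof (continuousOn_entII B) hρ).1
  rw [entOF, entOF, ht]
  refine ((isLeast_convexRoof (continuousOn_entII A) hρ).2
    ⟨m, p, π, hp, hp1, hπ, hρπ, rfl⟩).trans ?_
  refine Finset.sum_le_sum fun i _ => mul_le_mul_of_nonneg_left ?_ (hp i)
  obtain ⟨β, hβ, hmin⟩ := exists_entII_eq B (π i)
  rw [hmin]
  exact entII_le_entI (h hβ) _

/-! ### States that distinguish the partitions -/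

/-- The basis label all of whose entries on `J` are `1` and all of whose other entries are `0`. -/
def indicatorConfig (hd : ∀ a, 1 < d a) (J : Finset L) : Config d :=
  fun a => if a ∈ J then ⟨1, hd a⟩ else ⟨0, zero_lt_one.trans (hd a)⟩

/-- The Greenberger–Horne–Zeilinger vector `(|0…0⟩ + |1…1⟩) / √2` of the subsystem `K`. -/
def ghzVec (hd : ∀ a, 1 < d a) (K : Finset L) : SubConfig d K → ℂ :=
  fun v => if v = (fun a : K => indicatorConfig hd ∅ a) ∨
    v = (fun a : K => indicatorConfig hd K a) then ((√2)⁻¹ : ℝ) else 0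

/-- The product of the Greenberger–Horne–Zeilinger states of the parts of `β`. -/
def ghzState (hd : ∀ a, 1 < d a) (β : PI L) : Op d :=
  tensorParts β fun K => vecMulVec (ghzVec hd K) (star (ghzVec hd K))

theorem ghzState_mem_sepPure (hd : ∀ a, 1 < d a) (β : PI L) : ghzState hd β ∈ sepPure d β := by
  refine ⟨_, fun K hK => vecMulVec_mem_pureStates ?_, rfl⟩
  obtain ⟨a, ha⟩ := β.nonempty_of_mem_parts hK
  have hne : (fun a : K => indicatorConfig hd K a : SubConfig d K) ≠
      fun a : K => indicatorConfig hd ∅ a := by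
    intro h
    have := congrFun h ⟨a, ha⟩
    simp [indicatorConfig, ha] at this
  have h2 : ((√2)⁻¹ : ℝ) * ((√2)⁻¹ : ℝ) = 1 / 2 := by
    rw [← mul_inv, Real.mul_self_sqrt (by norm_num)]; norm_num
  have h3 : ∀ v, star (ghzVec hd K) v * ghzVec hd K v =
      (if v = (fun a : K => indicatorConfig hd ∅ a) then (1 / 2 : ℂ) else 0) +
      (if v = (fun a : K => indicatorConfig hd K a) then (1 / 2 : ℂ) else 0) := by
    intro v
    have h4 : (starRingEnd ℂ) (((√2)⁻¹ : ℝ) : ℂ) * (((√2)⁻¹ : ℝ) : ℂ) = 1 / 2 := by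
      rw [Complex.conj_ofReal, ← Complex.ofReal_mul, h2]
      norm_num
    rw [Pi.star_apply, Complex.star_def, ghzVec]
    by_cases h0 : v = (fun a : K => indicatorConfig hd ∅ a)
    · rw [if_pos (Or.inl h0), if_pos h0, if_neg fun h => hne (h.symm.trans h0), h4, add_zero]
    · by_cases h1 : v = (fun a : K => indicatorConfig hd K a)
      · rw [if_pos (Or.inr h1), if_neg h0, if_pos h1, h4, zero_add]
      · rw [if_neg (by tauto), if_neg h0, if_neg h1]
        simp
  rw [dotProduct, Finset.sum_congr rfl fun v _ => h3 v, Finset.sum_add_distrib]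
  simp
  norm_num

theorem ghzState_apply_self_ne_zero (hd : ∀ a, 1 < d a) (β : PI L) {x : Config d}
    (h : ∀ K ∈ β.parts, (fun a => x a : SubConfig d K) = (fun a : K => indicatorConfig hd ∅ a) ∨
      (fun a => x a : SubConfig d K) = fun a : K => indicatorConfig hd K a) :
    ghzState hd β x x ≠ 0 := by
  refine Finset.prod_ne_zero_iff.mpr fun K hK => ?_
  change ghzVec hd K _ * star (ghzVec hd K _) ≠ 0
  rw [ghzVec, if_pos (h K hK)]
  simp

theorem tensorParts_apply_self_mul_apply_self (α : PI L)
    (φ : (K : Finset L) → Matrix (SubConfig d K) (SubConfig d K) ℂ) {K : Finset L}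
    (hK : K ∈ α.parts) (x y : Config d) :
    tensorParts α φ x x * tensorParts α φ y y =
      tensorParts α φ (fun a => if a ∈ K then y a else x a)
          (fun a => if a ∈ K then y a else x a) *
        tensorParts α φ (fun a => if a ∈ K then x a else y a)
          (fun a => if a ∈ K then x a else y a) := by
  simp only [tensorParts, of_apply, ← Finset.prod_mul_distrib]
  refine Finset.prod_congr rfl fun K' hK' => ?_
  rcases eq_or_ne K' K with rfl | hne
  · have h1 : ∀ u v : Config d,
        (fun a : K' => if (a : L) ∈ K' then u a else v a) = fun a : K' => u a := by
      intro u v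
      funext a
      simp
    rw [h1, h1, mul_comm]
  · have h1 : ∀ u v : Config d,
        (fun a : K' => if (a : L) ∈ K then u a else v a) = fun a : K' => v a := by
      intro u v
      funext a
      exact if_neg fun h => hne (α.eq_of_mem_parts hK' hK a.2 h)
    rw [h1, h1]

/-- If a part `J` of `β` meets a part `K` of `α` and its complement, then exchanging the entries
on `K` of the labels `0…0` and `1…1` of `J` leads out of the support of the state. -/
theorem le_of_ghzState_mem_sepPure (hd : ∀ a, 1 < d a) {α β : PI L}
    (h : ghzState hd β ∈ sepPure d α) : β ≤ α := by
  obtain ⟨φ, -, hφ⟩ := h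
  intro J hJ
  obtain ⟨a, ha⟩ := β.nonempty_of_mem_parts hJ
  refine ⟨α.part a, α.part_mem.mpr (Finset.mem_univ a), ?_⟩
  have haK : a ∈ α.part a := α.mem_part (Finset.mem_univ a)
  by_contra hJK
  obtain ⟨b, hb, hbK⟩ := Finset.not_subset.mp hJK
  have hx : ghzState hd β (indicatorConfig hd ∅) (indicatorConfig hd ∅) ≠ 0 :=
    ghzState_apply_self_ne_zero hd β fun K _ => Or.inl rfl
  have hy : ghzState hd β (indicatorConfig hd J) (indicatorConfig hd J) ≠ 0 := by
    refine ghzState_apply_self_ne_zero hd β fun K hK => ?_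
    rcases eq_or_ne K J with rfl | hne
    · exact Or.inr rfl
    · refine Or.inl (funext fun c => ?_)
      have hc : (c : L) ∉ J := fun h => hne (β.eq_of_mem_parts hK hJ c.2 h)
      simp [indicatorConfig, hc]
  refine mul_ne_zero hx hy ?_
  rw [hφ, tensorParts_apply_self_mul_apply_self α φ (α.part_mem.mpr (Finset.mem_univ a)), ← hφ]
  refine mul_eq_zero_of_left (Finset.prod_eq_zero hJ ?_) _
  refine mul_eq_zero_of_left (if_neg ?_) _
  rintro (h0 | h1)
  · have := congrFun h0 ⟨a, ha⟩
    simp [indicatorConfig, ha, haK] at this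
  · have := congrFun h1 ⟨b, hb⟩
    simp [indicatorConfig, hb, hbK] at this

theorem le_iff_forall_entOF_le (hd : ∀ a, 1 < d a) {A B : PII L} :
    B ≤ A ↔ ∀ ρ ∈ mixedStates (Config d), entOF A ρ ≤ entOF B ρ := by
  refine ⟨fun h ρ hρ => entOF_anti h hρ, fun h β hβ => ?_⟩
  have hsep := ghzState_mem_sepPure hd β
  have hpure := sepPure_subset_pureStates β hsep
  have hmixed := pureStates_subset_mixedStates hpure
  have hB : entOF B (ghzState hd β) = 0 :=
    (mem_sepMixedII_iff B hmixed).mp (subset_convexHull ℝ _ (Set.mem_iUnion₂.mpr ⟨β, hβ, hsep⟩))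
  have hA : ghzState hd β ∈ sepMixedII d A := (mem_sepMixedII_iff A hmixed).mpr
    (le_antisymm ((h _ hmixed).trans_eq hB) (entOF_nonneg A hmixed))
  obtain ⟨α, hα, hmem⟩ := Set.mem_iUnion₂.mp (mem_of_mem_convexHull_of_mem_pureStates
    (Set.iUnion₂_subset fun α _ => sepPure_subset_pureStates α) hpure hA)
  exact A.1.lower (le_of_ghzState_mem_sepPure hd hmem) hα

theorem log_finrank_hilbertSpace (hd : ∀ a, 0 < d a) :
    Real.log (Module.finrank ℂ (HilbertSpace d)) = ∑ a, Real.log (d a) := by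
  rw [finrank_euclideanSpace, Fintype.card_pi, Nat.cast_prod,
    Real.log_prod fun a _ => by simpa using (hd a).ne']
  simp

end EntOF

end PartialEnt

end

theorem mainTheorem9 {L : Type*} [Fintype L] [DecidableEq L] [Nonempty L]
    (d : L → ℕ) (hd : ∀ a, 1 < d a) :
    (∀ A : PartialEnt.PII L,
      -- the minimum over the pure state decompositions exists
      (∀ ρ ∈ PartialEnt.mixedStates (PartialEnt.Config d),
        IsLeast (PartialEnt.roofValues (PartialEnt.entII A) ρ) (PartialEnt.entOF A ρ)) ∧
      PartialEnt.IsEntanglementMonotone (d := d) (PartialEnt.entOF A) ∧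
      (∀ ρ ∈ PartialEnt.mixedStates (PartialEnt.Config d),
        ρ ∈ PartialEnt.sepMixedII d A ↔ PartialEnt.entOF A ρ = 0) ∧
      (∀ ρ ∈ PartialEnt.mixedStates (PartialEnt.Config d),
        0 ≤ PartialEnt.entOF A ρ ∧
        PartialEnt.entOF A ρ ≤
          (1 / 2) * Real.log (Module.finrank ℂ (PartialEnt.HilbertSpace d)))) ∧
    (1 / 2) * Real.log (Module.finrank ℂ (PartialEnt.HilbertSpace d)) =
      (1 / 2) * ∑ a, Real.log (d a) ∧
    (∀ B A : PartialEnt.PII L,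
      B ≤ A ↔ ∀ ρ ∈ PartialEnt.mixedStates (PartialEnt.Config d),
        PartialEnt.entOF A ρ ≤ PartialEnt.entOF B ρ) := by
  have hd0 : ∀ a, 0 < d a := fun a => zero_lt_one.trans (hd a)
  rw [PartialEnt.log_finrank_hilbertSpace hd0]
  refine ⟨fun A => ⟨fun ρ hρ => ?_, ?_, fun ρ hρ => ?_, fun ρ hρ => ⟨?_, ?_⟩⟩, rfl,
    fun B A => PartialEnt.le_iff_forall_entOF_le hd⟩
  · exact PartialEnt.isLeast_convexRoof (PartialEnt.continuousOn_entII A) hρ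
  · exact PartialEnt.isEntanglementMonotone_entOF A
  · exact PartialEnt.mem_sepMixedII_iff A hρ
  · exact PartialEnt.entOF_nonneg A hρ
  · exact PartialEnt.entOF_le A hd0 hρ
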